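/- **Setting.** Consider a discounted Markov decision process with finite state space $\mathcal X$, finite nonempty action space $\mathcal A$ of size $A$, rewards $r(x,a)\in[0,1]$, transition probabilities $p(x'|x,a)$, discount factor $\gamma\in(0,1)$ and fixed initial state $x_0$. It is *linear*: for a known feature map $\varphi:\mathcal X\times\mathcal A\to\mathbb R^d$ there are $\psi:\mathcal X\to\mathbb R^d$ and $\omega\in\mathbb R^d$ with $r(x,a)=\langle\varphi(x,a),\omega\rangle$ and $p(x'|x,a)=\langle\varphi(x,a),\psi(x')\rangle$, where $\|\omega\|_2\le\sqrt d$, $\|\sum_x v(x)\psi(x)\|_2\le B\sqrt d$ for all $v\in[-B,B]^{\mathcal X}$, and $\|\varphi(x,a)\|_2\le R$ for some $R\ge1$. For a stationary stochastic policy $\pi$ let $\mu^\pi(x,a)=(1-\gamma)\sum_{k\ge0}\gamma^k\,\mathbb P_\pi[x_k=x,a_k=a]$ be its occupancy measure (with $x_0$ as initial state) and $\lambda^\pi=\sum_{x,a}\mu^\pi(x,a)\varphi(x,a)$ its feature occupancy. The data are $n\ge1$ transitions $(X_i,A_i,R_i,X_i')$ with $R_i=r(X_i,A_i)$ and, conditionally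 on the first $i-1$ transitions and on $(X_i,A_i)$, $X_i'\sim p(\cdot|X_i,A_i)$; the pairs $(X_i,A_i)$ are otherwise arbitrary. Write $\varphi_i=\varphi(X_i,A_i)$, $\Lambda=\beta I+\frac1n\sum_i\varphi_i\varphi_i^{\top}$, $\|\lambda\|^2_{\Lambda^{-1}}=\lambda^{\top}\Lambda^{-1}\lambda$, $v_{\theta,\pi}(x)=\sum_a\pi(a|x)\langle\theta,\varphi(x,a)\rangle$, $\widehat\Psi v=\frac1n\Lambda^{-1}\sum_i\varphi_i v(X_i')$. **Algorithm (FOGAS).** Let $\lambda_1=0$ and $\pi_1$ be the uniform policy. (This is the softmax policy with parameter $0$, so it lies in the class of softmax policies with parameter of norm at most $D_\pi=\alpha TD_\theta$.) For $t=1,\dots,T$, with $T\ge1$: * $\widehat g_t=(1-\gamma)\sum_a\pi_t(a|x_0)\varphi(x_0,a)+\frac{\gamma}{n}\sum_i\sum_a\pi_t(a|X_i')\varphi(X_i',a)\langle\varphi_i,\Lambda^{-1}\lambda_t\rangle$; * $\theta_t\in\arg\min_{\|\theta\|_2\le D_\theta}\langle\theta,\widehat g_t-\lambda_t\rangle$,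 with ties broken arbitrarily; * $\pi_{t+1}(a|x)\propto\exp\bigl(\alpha\langle\varphi(x,a),\sum_{k=1}^t\theta_k\rangle\bigr)$; * $\lambda_{t+1}=\frac{1}{1+\varrho\eta}\bigl(\lambda_t+\eta\Lambda(\omega+\gamma\widehat\Psi v_{\theta_t,\pi_t}-\theta_t)\bigr)$. The output is $\pi_J$ with $J$ uniform on $\{1,\dots,T\}$. **Theorem.** There is an absolute constant $C>0$ such that the following holds in every such setting and for every $\delta>0$. Let $D_\theta=\sqrt d/(1-\gamma)$, $\beta=R^2/(dT)$, $T\ge\frac{2R^2n\log A}{\log(1/\delta)}$, $$\alpha=\sqrt{\frac{2(1-\gamma)^2\log A}{R^2dT}},\qquad \varrho=\gamma\sqrt{\frac{320\,d^2\log(2T/\delta)}{(1-\gamma)^2n}},\qquad \eta=\sqrt{\frac{(1-\gamma)^2}{27R^2d^2T}}.$$ Then, with probability at least $1-\delta$ over the data, for every run of the algorithm (that is, for every way of breaking ties) and, simultaneously, for every stationary comparator policy $\pi^*$, $$\mathbb E_J\bigl[\langle\mu^{\pi^*}-\mu^{\pi_J},r\rangle\bigr]\;\le\; C\,R\cdot\frac{\|\lambda^{\pi^*}\|^2_{\Lambda^{-1}}+1}{1-\gamma}\cdot\sqrt{\frac{d^2\log(2T/\delta)}{n}}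 .$$ In particular, for feature bound $R$ regarded as a fixed constant, the expected suboptimality is $O\Bigl(\frac{\|\lambda^{\pi^*}\|^2_{\Lambda^{-1}}+1}{1-\gamma}\sqrt{\frac{d^2\log(2T/\delta)}{n}}\Bigr)$. The algorithm uses no prior bound on $\|\lambda^{\pi^*}\|^2_{\Lambda^{-1}}$. -/

import Mathlib

open MeasureTheory Matrix

noncomputable section

namespace FOGAS

/-- A finite discounted Markov decision process with rewards in `[0, 1]`, a fixed initial state `x₀`
and discount factor `γ ∈ (0, 1)`. -/
structure MDP (X A : Type*) [Fintype X] where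
  /-- reward function -/
  r : X → A → ℝ
  /-- transition probabilities: `p x a x'` is the probability of moving to `x'` from `(x, a)` -/
  p : X → A → X → ℝ
  /-- discount factor -/
  γ : ℝ
  /-- initial state -/
  x₀ : X
  r_nonneg : ∀ x a, 0 ≤ r x a
  r_le_one : ∀ x a, r x a ≤ 1
  p_nonneg : ∀ x a x', 0 ≤ p x a x'
  p_sum : ∀ x a, ∑ x', p x a x' = 1
  γ_pos : 0 < γ
  γ_lt_one : γ < 1

/-- Stationary stochastic policies; `prob x a` is the probability of playing `a` in state `x`. -/
@[ext] structure Policy (X A : Type*) [Fintype A] where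
  prob : X → A → ℝ
  nonneg : ∀ x a, 0 ≤ prob x a
  sum_one : ∀ x, ∑ a, prob x a = 1

/-- The Euclidean norm of a vector. -/
def l2norm {d : ℕ} (v : Fin d → ℝ) : ℝ := ‖WithLp.toLp 2 v‖

/-- The Euclidean ball of radius `D` around the origin. -/
def euclBall (d : ℕ) (D : ℝ) : Set (Fin d → ℝ) := {v | l2norm v ≤ D}

section MDPs

variable {X A : Type*} [Fintype X] [Fintype A]

/-- The law of the state `x_k` when the process starts in `x₀` and follows `π`. -/
def MDP.stateLaw [DecidableEq X] (M : MDP X A) (π : Policy X A) : ℕ → X → ℝ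
  | 0 => fun x => if x = M.x₀ then 1 else 0
  | k + 1 => fun x' => ∑ x, ∑ a, M.stateLaw π k x * π.prob x a * M.p x a x'

/-- The normalized discounted state-action occupancy measure
`μ^π(x, a) = (1 - γ) ∑_k γ^k ℙ[x_k = x, a_k = a]`. -/
def MDP.occupancy [DecidableEq X] (M : MDP X A) (π : Policy X A) (x : X) (a : A) : ℝ :=
  (1 - M.γ) * ∑' k : ℕ, M.γ ^ k * (M.stateLaw π k x * π.prob x a)

/-- The normalized return `⟨μ^π, r⟩`. -/
def MDP.ret [DecidableEq X] (M : MDP X A) (π : Policy X A) : ℝ :=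
  ∑ x, ∑ a, M.occupancy π x a * M.r x a

/-- The feature occupancy `λ^π = Φᵀ μ^π`. -/
def MDP.featOcc [DecidableEq X] {d : ℕ} (M : MDP X A) (φ : X → A → Fin d → ℝ)
    (π : Policy X A) : Fin d → ℝ :=
  ∑ x, ∑ a, M.occupancy π x a • φ x a

/-- The MDP is linear for the feature map `φ`, with weights `ψ`, `w` and feature bound `R`. -/
structure MDP.IsLinear {d : ℕ} (M : MDP X A) (φ : X → A → Fin d → ℝ)
    (ψ : X → Fin d → ℝ) (w : Fin d → ℝ) (R : ℝ) : Prop where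
  reward_eq : ∀ x a, M.r x a = φ x a ⬝ᵥ w
  trans_eq : ∀ x a x', M.p x a x' = φ x a ⬝ᵥ ψ x'
  norm_w : l2norm w ≤ √d
  norm_psi : ∀ (B : ℝ) (v : X → ℝ), (∀ x, |v x| ≤ B) → l2norm (∑ x, v x • ψ x) ≤ B * √d
  norm_feat : ∀ x a, l2norm (φ x a) ≤ R
  one_le : 1 ≤ R

end MDPs

section Policies

variable {X A : Type*} [Fintype A]

/-- The uniform policy. -/
def uniformPolicy (X A : Type*) [Fintype A] [Nonempty A] : Policy X A where
  prob _ _ := (Fintype.card A : ℝ)⁻¹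
  nonneg _ _ := by positivity
  sum_one _ := by simp

/-- The softmax policy `π(a|x) ∝ exp ⟨φ(x, a), ϑ⟩`. -/
def softmaxPolicy [Nonempty A] {d : ℕ} (φ : X → A → Fin d → ℝ) (ϑ : Fin d → ℝ) : Policy X A where
  prob x a := Real.exp (φ x a ⬝ᵥ ϑ) / ∑ b, Real.exp (φ x b ⬝ᵥ ϑ)
  nonneg _ _ := by positivity
  sum_one x := by
    rw [← Finset.sum_div]
    exact div_self (Finset.sum_pos (fun _ _ => Real.exp_pos _) Finset.univ_nonempty).ne'

/-- The class of softmax policies with parameter in the Euclidean ball of radius `D`. -/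
def softmaxClass [Nonempty A] {d : ℕ} (φ : X → A → Fin d → ℝ) (D : ℝ) : Set (Policy X A) :=
  {π | ∃ ϑ ∈ euclBall d D, π = softmaxPolicy φ ϑ}

end Policies

/-- One record `(X_i, A_i, R_i, X'_i)` of the data set. -/
structure Sample (X A : Type*) where
  state : X
  action : A
  reward : ℝ
  next : X

/-- `D` is a random data set of `n` transitions of `M`: rewards are `R_i = r(X_i, A_i)`, and,
conditionally on all the previous records and on `(X_i, A_i)`, the next state `X'_i` has law
`p(· | X_i, A_i)`. The pairs `(X_i, A_i)` are otherwise arbitrary; they may depend on each other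
and on the earlier next states. The conditional law is written out on each possible history `h`
(there are finitely many). -/
structure IsOfflineData {X A Ω : Type*} [Fintype X] [MeasurableSpace Ω] (M : MDP X A)
    (P : Measure Ω) {n : ℕ} (D : Ω → Fin n → Sample X A) : Prop where
  measurable : ∀ i x a x',
    MeasurableSet {ω | (D ω i).state = x ∧ (D ω i).action = a ∧ (D ω i).next = x'}
  reward_eq : ∀ ω i, (D ω i).reward = M.r (D ω i).state (D ω i).action
  next_law : ∀ (i : Fin n) (h : Fin n → X × A × X),
    P.real {ω | (∀ j < i, ((D ω j).state, (D ω j).action, (D ω j).next) = h j) ∧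
        (D ω i).state = (h i).1 ∧ (D ω i).action = (h i).2.1 ∧ (D ω i).next = (h i).2.2} =
      P.real {ω | (∀ j < i, ((D ω j).state, (D ω j).action, (D ω j).next) = h j) ∧
        (D ω i).state = (h i).1 ∧ (D ω i).action = (h i).2.1} *
      M.p (h i).1 (h i).2.1 (h i).2.2

section Algorithm

variable {X A : Type*} [Fintype A] {d n : ℕ}

/-- The feature vector `φ_i = φ(X_i, A_i)` of a record. -/
def Sample.feat (φ : X → A → Fin d → ℝ) (s : Sample X A) : Fin d → ℝ := φ s.state s.action

/-- The regularized empirical covariance `Λ = β I + (1/n) ∑ φ_i φ_iᵀ`. -/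
def covMatrix (φ : X → A → Fin d → ℝ) (β : ℝ) (D : Fin n → Sample X A) :
    Matrix (Fin d) (Fin d) ℝ :=
  β • (1 : Matrix (Fin d) (Fin d) ℝ) +
    (n : ℝ)⁻¹ • ∑ i, vecMulVec ((D i).feat φ) ((D i).feat φ)

/-- The squared weighted norm `‖v‖²_{Λ⁻¹} = vᵀ Λ⁻¹ v`. -/
def invNormSq (Λ : Matrix (Fin d) (Fin d) ℝ) (v : Fin d → ℝ) : ℝ := v ⬝ᵥ (Λ⁻¹ *ᵥ v)

/-- `v_{θ,π}(x) = ∑_a π(a|x) ⟨θ, φ(x, a)⟩`. -/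
def valueOf (φ : X → A → Fin d → ℝ) (θ : Fin d → ℝ) (π : Policy X A) (x : X) : ℝ :=
  ∑ a, π.prob x a * (θ ⬝ᵥ φ x a)

/-- The least-squares transition estimate applied to `v`:
`Ψ̂ v = (1/n) Λ⁻¹ ∑ φ_i v(X'_i)`. -/
def psiHat (φ : X → A → Fin d → ℝ) (β : ℝ) (D : Fin n → Sample X A) (v : X → ℝ) : Fin d → ℝ :=
  (n : ℝ)⁻¹ • ((covMatrix φ β D)⁻¹ *ᵥ ∑ i, v (D i).next • (D i).feat φ)

/-- The estimated feature occupancy `Φᵀ μ̂_{λ,π}`, equal to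
`(1-γ) ∑_a π(a|x₀) φ(x₀,a) + γ (1/n) ∑_i ∑_a π(a|X'_i) φ(X'_i,a) ⟨φ_i, Λ⁻¹ λ⟩`. -/
def featOccHat (φ : X → A → Fin d → ℝ) (γ : ℝ) (x₀ : X) (β : ℝ) (D : Fin n → Sample X A)
    (lam : Fin d → ℝ) (π : Policy X A) : Fin d → ℝ :=
  (1 - γ) • ∑ a, π.prob x₀ a • φ x₀ a +
    (γ * (n : ℝ)⁻¹) • ∑ i, ∑ a,
      (π.prob (D i).next a * ((D i).feat φ ⬝ᵥ ((covMatrix φ β D)⁻¹ *ᵥ lam))) • φ (D i).next a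

/-- The sequences `lam, π, θ` (indexed by `t = 1, …, T`, and `T + 1` for `lam` and `π`) are iterates
of the algorithm on the data set `D`, with initial policy `π₁`, `λ₁ = 0`, learning rates `α, ϱ, η`,
regularization `β`, and radii `Dθ`, `Dπ`. Ties in the `argmin` are broken arbitrarily.
Only the features `φ`, the reward weights `w`, the discount `γ`, the initial state `x₀` and the
data enter; the transition weights do not. -/
structure IsRun [Nonempty A] (φ : X → A → Fin d → ℝ) (w : Fin d → ℝ) (γ : ℝ) (x₀ : X)
    (D : Fin n → Sample X A) (T : ℕ) (α ϱ η β Dθ Dπ : ℝ) (π₁ : Policy X A)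
    (lam : ℕ → Fin d → ℝ) (π : ℕ → Policy X A) (θ : ℕ → Fin d → ℝ) : Prop where
  lam_init : lam 1 = 0
  pi_init : π 1 = π₁
  pi_init_mem : π₁ ∈ softmaxClass φ Dπ
  theta_mem : ∀ t ∈ Finset.Icc 1 T, θ t ∈ euclBall d Dθ
  theta_min : ∀ t ∈ Finset.Icc 1 T,
    IsMinOn (fun ϑ => ϑ ⬝ᵥ (featOccHat φ γ x₀ β D (lam t) (π t) - lam t)) (euclBall d Dθ) (θ t)
  pi_step : ∀ t ∈ Finset.Icc 1 T,
    π (t + 1) = softmaxPolicy φ (α • ∑ k ∈ Finset.Icc 1 t, θ k)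
  lam_step : ∀ t ∈ Finset.Icc 1 T,
    lam (t + 1) = (1 / (1 + ϱ * η)) •
      (lam t + η • (covMatrix φ β D *ᵥ
        (w + γ • psiHat φ β D (valueOf φ (θ t) (π t)) - θ t)))

end Algorithm

end FOGAS

end

/-! Let y = Λ⁻¹λ and write ⟨·,·⟩ for `covForm`, so that the weighted norm of λ is ⟨y,y⟩. The
Lagrangian (1-γ)v_{θ,π}(x₀) + λ·(ω + γΨv_{θ,π} - θ) returns two things. At the feature occupancy of
the comparator it is the comparator's return, up to a policy-improvement term
(`MDP.IsLinear.ret_eq_lagrangian`). At the true action-value weights of π_t it is the return of π_t,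
whatever λ is (`MDP.IsLinear.exists_value_weights`). The algorithm sees the Lagrangian with Ψ̂ in
place of Ψ, and θ_t minimizes it. Comparing the two points gives, in each round,

ret(π*) - ret(π_t) ≤ (policy regret) + ⟨y* - y_t, g_t⟩ - γ⟨y*, Δ_t⟩ + γ⟨y_t, Δ'_t⟩,

where g_t is the empirical Bellman residual and Δ_t, Δ'_t are the errors of Ψ̂ on the value
functions of θ_t and of π_t. The first term is regret of exponential weights in each state
(`exponentialWeights_regret`), the second is regret of regularized gradient ascent in the Λ-geometry
(`ascent_regret`).

The last term is the delicate one, because y_t has no a priori bound. Young's inequality charges ϱ/2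
⟨y_t,y_t⟩ for it, and the regularizer in the ascent step pays back exactly this amount. What remains
involves only ⟨y*,y*⟩, so no bound on it is needed for tuning (`IsRun.sum_ret_sub_le`).

The errors Δ must be controlled for data-dependent θ_t and π_t. All iterates lie in a class
parametrized by two vectors, so an exponential inequality over a grid of parameters and directions,
plus a union bound, gives squared error of order b² d log(T/δ)/n for values bounded by b
(`NoiseConcentrated.covForm_noiseFit_le`). The grid is polynomial in 2T/δ once the trivial regimes
are set aside. -/

noncomputable section

namespace FOGAS

/-! ### Positive semidefinite forms and regularized gradient ascent. -/

section BilinearForms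

variable {V : Type*} [AddCommGroup V] [Module ℝ V] {B : V →ₗ[ℝ] V →ₗ[ℝ] ℝ}

/-- Young's inequality for a positive semidefinite form. -/
theorem two_mul_form_le (hs : ∀ x y, B x y = B y x) (hp : ∀ x, 0 ≤ B x x) {c : ℝ} (hc : 0 < c)
    (x y : V) : 2 * B x y ≤ c * B x x + B y y / c := by
  have h := hp (c • x - y)
  simp only [map_sub, LinearMap.sub_apply, map_smul, LinearMap.smul_apply, smul_eq_mul,
    hs y x] at h
  have h2 : c * (2 * B x y) ≤ c * (c * B x x + B y y / c) := by
    rw [mul_add, mul_div_cancel₀ _ hc.ne']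
    linarith
  exact le_of_mul_le_mul_left h2 hc

theorem form_add_le (hs : ∀ x y, B x y = B y x) (hp : ∀ x, 0 ≤ B x x) (x y : V) :
    B (x + y) (x + y) ≤ 2 * B x x + 2 * B y y := by
  have h := two_mul_form_le hs hp one_pos x y
  simp only [map_add, LinearMap.add_apply, hs y x]
  linarith

theorem form_sub_le (hs : ∀ x y, B x y = B y x) (hp : ∀ x, 0 ≤ B x x) (x y : V) :
    B (x - y) (x - y) ≤ 2 * B x x + 2 * B y y := by
  have h := form_add_le hs hp x (-y)
  simpa [sub_eq_add_neg] using h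

/-- Progress of one step of regularized gradient ascent. -/
theorem ascent_step (hs : ∀ x y, B x y = B y x) (hp : ∀ x, 0 ≤ B x x) {ϱ η : ℝ}
    (hϱ : 0 ≤ ϱ) (hη : 0 ≤ η) (x y y' g : V) (h : (1 + ϱ * η) • y' = y + η • g) :
    η * B (x - y) g ≤ (B (x - y) (x - y) - B (x - y') (x - y')) / 2 +
      ϱ * η / 2 * (B x x - B y' y') + η ^ 2 / 2 * B g g := by
  -- The step is implicit in the regularizer: it is evaluated at `y'`. Polarization then turns the
  -- pairings with `x - y'` into differences of squares, and Young's `B (y' - y) (y' - y)` cancels.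
  have hg : η • g = (y' - y) + (ϱ * η) • y' := by
    rw [add_smul, one_smul] at h
    rw [← sub_eq_iff_eq_add'.mpr h]; abel
  have e1 : η * B (x - y) g = B (x - y') (η • g) + B (y' - y) (η • g) := by
    rw [← LinearMap.add_apply, ← map_add, sub_add_sub_cancel]; simp
  have e2 := two_mul_form_le hs hp one_pos (y' - y) (η • g)
  have e3 : B (η • g) (η • g) = η ^ 2 * B g g := by simp; ring
  rw [e3] at e2
  have e4 := mul_nonneg (mul_nonneg hϱ hη) (hp (x - y'))
  rw [e1, hg]
  rw [hg] at e2
  simp only [map_sub, LinearMap.sub_apply, map_smul, LinearMap.smul_apply, smul_eq_mul, map_add,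
    hs y' x, hs y x, hs y' y] at *
  linarith

/-- Regret bound for regularized gradient ascent started at the origin. -/
theorem ascent_regret (hs : ∀ x y, B x y = B y x) (hp : ∀ x, 0 ≤ B x x) {ϱ η : ℝ}
    (hϱ : 0 ≤ ϱ) (hη : 0 < η) (T : ℕ) (x : V) (y g : ℕ → V) (h1 : y 1 = 0)
    (h : ∀ t ∈ Finset.Icc 1 T, (1 + ϱ * η) • y (t + 1) = y t + η • g t) :
    ∑ t ∈ Finset.Icc 1 T, B (x - y t) (g t) ≤ B x x / (2 * η) +
      ϱ / 2 * (T * B x x - ∑ t ∈ Finset.Icc 1 T, B (y t) (y t)) +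
      η / 2 * ∑ t ∈ Finset.Icc 1 T, B (g t) (g t) := by
  -- Each step is credited with `y (t + 1)`. As `y 1 = 0`, the shifted sum is the sum over `y t`
  -- plus a boundary term, which is dropped at the end.
  have key : ∀ S ≤ T, η * ∑ t ∈ Finset.Icc 1 S, B (x - y t) (g t) ≤
      (B x x - B (x - y (S + 1)) (x - y (S + 1))) / 2 +
      ϱ * η / 2 * (S * B x x - ∑ t ∈ Finset.Icc 1 S, B (y t) (y t) - B (y (S + 1)) (y (S + 1))) +
      η ^ 2 / 2 * ∑ t ∈ Finset.Icc 1 S, B (g t) (g t) := by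
    intro S
    induction S with
    | zero => intro _; simp [h1]
    | succ S ih =>
      intro hS
      have ih := ih (by omega)
      have st := ascent_step hs hp hϱ hη.le x _ _ _ (h (S + 1) (by simp; omega))
      rw [Finset.sum_Icc_succ_top (by omega), Finset.sum_Icc_succ_top (by omega),
        Finset.sum_Icc_succ_top (by omega)]
      push_cast
      linarith
  have k := key T le_rfl
  have n1 := hp (x - y (T + 1))
  have n2 := mul_nonneg (mul_nonneg hϱ hη.le) (hp (y (T + 1)))
  refine le_of_mul_le_mul_left (k.trans ?_) hη
  have : η * (B x x / (2 * η)) = B x x / 2 := by field_simp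
  rw [mul_add, mul_add, this]
  linarith

end BilinearForms

/-! ### Euclidean norm estimates for coordinate vectors. -/

section Euclidean

variable {d : ℕ}

theorem l2norm_sq (v : Fin d → ℝ) : l2norm v ^ 2 = v ⬝ᵥ v := by
  rw [l2norm, EuclideanSpace.norm_sq_eq]
  simp [dotProduct, sq]

theorem l2norm_nonneg (v : Fin d → ℝ) : 0 ≤ l2norm v := norm_nonneg _

theorem abs_dotProduct_le (x y : Fin d → ℝ) : |x ⬝ᵥ y| ≤ l2norm x * l2norm y := by
  have h := abs_real_inner_le_norm (WithLp.toLp 2 y) (WithLp.toLp 2 x)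
  rw [EuclideanSpace.inner_toLp_toLp] at h
  simpa [l2norm, mul_comm] using h

theorem l2norm_add_le (x y : Fin d → ℝ) : l2norm (x + y) ≤ l2norm x + l2norm y := by
  simpa [l2norm] using norm_add_le (WithLp.toLp 2 x) (WithLp.toLp 2 y)

theorem l2norm_smul (c : ℝ) (x : Fin d → ℝ) : l2norm (c • x) = |c| * l2norm x := by
  simpa [l2norm] using norm_smul c (WithLp.toLp 2 x)

theorem l2norm_sum_le {ι : Type*} (s : Finset ι) (f : ι → Fin d → ℝ) :
    l2norm (∑ i ∈ s, f i) ≤ ∑ i ∈ s, l2norm (f i) := by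
  simpa [l2norm] using norm_sum_le s (fun i => WithLp.toLp 2 (f i))

theorem abs_apply_le_l2norm (x : Fin d → ℝ) (j : Fin d) : |x j| ≤ l2norm x := by
  simpa [l2norm] using PiLp.norm_apply_le (WithLp.toLp 2 x) j

theorem l2norm_le_of_abs_le {x : Fin d → ℝ} {ε : ℝ} (h : ∀ j, |x j| ≤ ε) :
    l2norm x ≤ d * ε := by
  rcases Nat.eq_zero_or_pos d with rfl | hd
  · simp [l2norm, EuclideanSpace.norm_eq]
  have hε : 0 ≤ ε := (abs_nonneg _).trans (h ⟨0, hd⟩)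
  have h1 : (1 : ℝ) ≤ d := by exact_mod_cast hd
  refine abs_le_of_sq_le_sq' ?_ (by positivity) |>.2
  rw [l2norm_sq]
  have : x ⬝ᵥ x ≤ ∑ _j : Fin d, ε ^ 2 := Finset.sum_le_sum fun j _ => by
    rw [← sq, ← sq_abs]; exact pow_le_pow_left₀ (abs_nonneg _) (h j) 2
  simp only [Finset.sum_const, Finset.card_univ, Fintype.card_fin, nsmul_eq_mul] at this
  nlinarith [mul_nonneg (mul_nonneg (sub_nonneg.2 h1) (zero_le_one.trans h1)) (sq_nonneg ε)]

end Euclidean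

/-! ### The empirical covariance form and ridge regression. -/

section Covariance

variable {X A : Type*} {d n : ℕ} (φ : X → A → Fin d → ℝ) (β : ℝ) (D : Fin n → Sample X A)

/-- The bilinear form `(x, y) ↦ xᵀ Λ y`. -/
def covForm : (Fin d → ℝ) →ₗ[ℝ] (Fin d → ℝ) →ₗ[ℝ] ℝ := Matrix.toBilin' (covMatrix φ β D)

theorem covForm_apply (x y : Fin d → ℝ) :
    covForm φ β D x y = x ⬝ᵥ (covMatrix φ β D *ᵥ y) :=
  Matrix.toBilin'_apply' _ _ _

theorem covForm_eq (x y : Fin d → ℝ) :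
    covForm φ β D x y =
      β * (x ⬝ᵥ y) + (n : ℝ)⁻¹ * ∑ i, ((D i).feat φ ⬝ᵥ x) * ((D i).feat φ ⬝ᵥ y) := by
  rw [covForm_apply, covMatrix, add_mulVec, smul_mulVec, one_mulVec, smul_mulVec, dotProduct_add,
    dotProduct_smul, dotProduct_smul, sum_mulVec, dotProduct_sum]
  simp only [vecMulVec_mulVec, smul_eq_mul]
  congr 2
  refine Finset.sum_congr rfl fun i _ => ?_
  simp [dotProduct_comm x, mul_comm]

theorem covForm_symm (x y : Fin d → ℝ) : covForm φ β D x y = covForm φ β D y x := by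
  simp only [covForm_eq, dotProduct_comm x y, mul_comm]

variable {β}

theorem covForm_ge (x : Fin d → ℝ) : β * (x ⬝ᵥ x) ≤ covForm φ β D x x := by
  rw [covForm_eq]
  have : 0 ≤ ∑ i, ((D i).feat φ ⬝ᵥ x) * ((D i).feat φ ⬝ᵥ x) :=
    Finset.sum_nonneg fun i _ => mul_self_nonneg _
  have : 0 ≤ (n : ℝ)⁻¹ * ∑ i, ((D i).feat φ ⬝ᵥ x) * ((D i).feat φ ⬝ᵥ x) := by positivity
  linarith

theorem sum_sq_le_covForm (hβ : 0 < β) (x : Fin d → ℝ) :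
    (n : ℝ)⁻¹ * ∑ i, ((D i).feat φ ⬝ᵥ x) ^ 2 ≤ covForm φ β D x x := by
  rw [covForm_eq]
  have h : 0 ≤ x ⬝ᵥ x := by rw [← l2norm_sq]; positivity
  simp only [sq]
  nlinarith [mul_nonneg hβ.le h]

theorem covForm_nonneg (hβ : 0 < β) (x : Fin d → ℝ) : 0 ≤ covForm φ β D x x := by
  have h : 0 ≤ x ⬝ᵥ x := by rw [← l2norm_sq]; positivity
  exact (mul_nonneg hβ.le h).trans (covForm_ge φ D x)

theorem covMatrix_isUnit_det (hβ : 0 < β) : IsUnit (covMatrix φ β D).det := by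
  rw [isUnit_iff_ne_zero]
  intro h
  obtain ⟨v, hv, h0⟩ := Matrix.exists_mulVec_eq_zero_iff.2 h
  have h1 := covForm_ge φ (β := β) D v
  rw [covForm_apply, h0, dotProduct_zero] at h1
  have h2 : 0 < v ⬝ᵥ v := by
    refine lt_of_le_of_ne (by rw [← l2norm_sq]; positivity) fun h3 => hv ?_
    exact dotProduct_self_eq_zero.1 h3.symm
  nlinarith

theorem covMatrix_mulVec_inv (hβ : 0 < β) (x : Fin d → ℝ) :
    covMatrix φ β D *ᵥ ((covMatrix φ β D)⁻¹ *ᵥ x) = x := by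
  rw [mulVec_mulVec, Matrix.mul_nonsing_inv _ (covMatrix_isUnit_det φ D hβ), one_mulVec]

theorem covMatrix_inv_mulVec (hβ : 0 < β) (x : Fin d → ℝ) :
    (covMatrix φ β D)⁻¹ *ᵥ (covMatrix φ β D *ᵥ x) = x := by
  rw [mulVec_mulVec, Matrix.nonsing_inv_mul _ (covMatrix_isUnit_det φ D hβ), one_mulVec]

theorem covForm_inv_left (hβ : 0 < β) (x y : Fin d → ℝ) :
    covForm φ β D ((covMatrix φ β D)⁻¹ *ᵥ x) y = x ⬝ᵥ y := by
  rw [covForm_symm, covForm_apply, covMatrix_mulVec_inv φ D hβ, dotProduct_comm]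

theorem invNormSq_eq_covForm (hβ : 0 < β) (x : Fin d → ℝ) :
    invNormSq (covMatrix φ β D) x =
      covForm φ β D ((covMatrix φ β D)⁻¹ *ᵥ x) ((covMatrix φ β D)⁻¹ *ᵥ x) := by
  rw [covForm_inv_left φ D hβ, invNormSq]

/-- A least-squares solution is bounded by its responses. -/
theorem covForm_leastSquares_le (hβ : 0 < β) (c : Fin n → ℝ) (y : Fin d → ℝ)
    (hy : covMatrix φ β D *ᵥ y = (n : ℝ)⁻¹ • ∑ i, c i • (D i).feat φ) :
    covForm φ β D y y ≤ (n : ℝ)⁻¹ * ∑ i, c i ^ 2 := by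
  have h1 : covForm φ β D y y = (n : ℝ)⁻¹ * ∑ i, c i * ((D i).feat φ ⬝ᵥ y) := by
    rw [covForm_apply, hy, dotProduct_comm, smul_dotProduct, sum_dotProduct]
    simp
  have h2 := sum_sq_le_covForm φ D hβ y
  -- The squares of the fitted values amount to at most half of the left side, which absorbs them.
  have h3 : ∑ i, c i * ((D i).feat φ ⬝ᵥ y) ≤ ∑ i, (c i ^ 2 + ((D i).feat φ ⬝ᵥ y) ^ 2) / 2 :=
    Finset.sum_le_sum fun i _ => by nlinarith [sq_nonneg (c i - (D i).feat φ ⬝ᵥ y)]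
  rw [← Finset.sum_div, Finset.sum_add_distrib] at h3
  have h4 := mul_le_mul_of_nonneg_left h3 (show 0 ≤ (n : ℝ)⁻¹ by positivity)
  linarith

/-- With q the left side, q = β y·z and β y·y ≤ q, so 2q ≤ q + β z·z. This is the bias caused by the
regularization. -/
theorem covForm_ridge_le (hβ : 0 < β) (z y : Fin d → ℝ) (hy : covMatrix φ β D *ᵥ y = β • z) :
    covForm φ β D y y ≤ β * l2norm z ^ 2 := by
  have h1 : covForm φ β D y y = β * (y ⬝ᵥ z) := by
    rw [covForm_apply, hy, dotProduct_smul, smul_eq_mul]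
  have h2 := covForm_ge φ (β := β) D y
  have h3 : 0 ≤ (y - z) ⬝ᵥ (y - z) := by rw [← l2norm_sq]; positivity
  simp only [dotProduct_sub, sub_dotProduct, dotProduct_comm z y] at h3
  rw [l2norm_sq]
  nlinarith [mul_nonneg hβ.le h3]

theorem covForm_le_of_feat_le {R : ℝ} (hn : 1 ≤ n) (hR : ∀ x a, l2norm (φ x a) ≤ R)
    (x : Fin d → ℝ) : covForm φ β D x x ≤ (β + R ^ 2) * l2norm x ^ 2 := by
  have hn' : (0 : ℝ) < n := by exact_mod_cast hn
  have h1 : ∑ i, ((D i).feat φ ⬝ᵥ x) * ((D i).feat φ ⬝ᵥ x) ≤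
      ∑ _i : Fin n, R ^ 2 * l2norm x ^ 2 := Finset.sum_le_sum fun i _ => by
    rw [← sq, ← sq_abs, ← mul_pow]
    refine pow_le_pow_left₀ (abs_nonneg _) ((abs_dotProduct_le _ _).trans ?_) 2
    exact mul_le_mul_of_nonneg_right (hR _ _) (l2norm_nonneg _)
  simp only [Finset.sum_const, Finset.card_univ, Fintype.card_fin, nsmul_eq_mul] at h1
  rw [covForm_eq, l2norm_sq] at *
  have h2 := mul_le_mul_of_nonneg_left h1 (show 0 ≤ (n : ℝ)⁻¹ by positivity)
  rw [inv_mul_cancel_left₀ hn'.ne'] at h2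
  linarith

end Covariance

/-! ### Occupancy measures and Bellman equations. -/

section MDPTheory

variable {X A : Type*} [Fintype X] [Fintype A]

section Occupancy

variable [DecidableEq X] (M : MDP X A) (π : Policy X A)

theorem MDP.stateLaw_nonneg (k : ℕ) (x : X) : 0 ≤ M.stateLaw π k x := by
  induction k generalizing x with
  | zero => simp only [MDP.stateLaw]; split_ifs <;> norm_num
  | succ k ih =>
    exact Finset.sum_nonneg fun y _ => Finset.sum_nonneg fun a _ =>
      mul_nonneg (mul_nonneg (ih y) (π.nonneg y a)) (M.p_nonneg y a x)

theorem MDP.sum_stateLaw (k : ℕ) : ∑ x, M.stateLaw π k x = 1 := by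
  induction k with
  | zero => simp [MDP.stateLaw]
  | succ k ih =>
    simp only [MDP.stateLaw]
    rw [Finset.sum_comm]
    rw [← ih]
    refine Finset.sum_congr rfl fun y _ => ?_
    rw [Finset.sum_comm]
    simp only [← Finset.mul_sum, M.p_sum, mul_one, π.sum_one]

theorem MDP.stateLaw_le_one (k : ℕ) (x : X) : M.stateLaw π k x ≤ 1 := by
  rw [← M.sum_stateLaw π k]
  exact Finset.single_le_sum (fun y _ => M.stateLaw_nonneg π k y) (Finset.mem_univ x)

theorem MDP.summable_stateLaw (x : X) : Summable fun k => M.γ ^ k * M.stateLaw π k x := by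
  refine Summable.of_nonneg_of_le
    (fun k => mul_nonneg (pow_nonneg M.γ_pos.le k) (M.stateLaw_nonneg π k x))
    (fun k => ?_) (summable_geometric_of_lt_one M.γ_pos.le M.γ_lt_one)
  exact mul_le_of_le_one_right (pow_nonneg M.γ_pos.le k) (M.stateLaw_le_one π k x)

/-- The normalized discounted state occupancy measure. -/
def MDP.stateOcc (x : X) : ℝ := (1 - M.γ) * ∑' k : ℕ, M.γ ^ k * M.stateLaw π k x

theorem MDP.occupancy_eq (x : X) (a : A) :
    M.occupancy π x a = M.stateOcc π x * π.prob x a := by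
  simp only [MDP.occupancy, MDP.stateOcc, ← mul_assoc, tsum_mul_right]

theorem MDP.stateOcc_nonneg (x : X) : 0 ≤ M.stateOcc π x :=
  mul_nonneg (sub_nonneg.2 M.γ_lt_one.le) (tsum_nonneg fun k =>
    mul_nonneg (pow_nonneg M.γ_pos.le k) (M.stateLaw_nonneg π k x))

theorem MDP.sum_stateOcc : ∑ x, M.stateOcc π x = 1 := by
  simp only [MDP.stateOcc]
  rw [← Finset.mul_sum, ← Summable.tsum_finsetSum fun x _ => M.summable_stateLaw π x]
  simp only [← Finset.mul_sum, M.sum_stateLaw, mul_one]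
  rw [tsum_geometric_of_lt_one M.γ_pos.le M.γ_lt_one]
  exact mul_inv_cancel₀ (sub_pos.2 M.γ_lt_one).ne'

/-- The Bellman flow equation. -/
theorem MDP.stateOcc_flow (x' : X) :
    M.stateOcc π x' = (1 - M.γ) * (if x' = M.x₀ then 1 else 0) +
      M.γ * ∑ x, ∑ a, M.occupancy π x a * M.p x a x' := by
  have hs : ∀ x a, Summable fun k => M.γ ^ k * M.stateLaw π k x * (π.prob x a * M.p x a x') :=
    fun x a => (M.summable_stateLaw π x).mul_right _
  have h1 : ∑' k : ℕ, M.γ ^ (k + 1) * M.stateLaw π (k + 1) x' =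
      M.γ * ∑ x, ∑ a, (∑' k : ℕ, M.γ ^ k * M.stateLaw π k x) * (π.prob x a * M.p x a x') := by
    simp only [← tsum_mul_right]
    have h2 : ∀ x, ∑ a, ∑' k : ℕ, M.γ ^ k * M.stateLaw π k x * (π.prob x a * M.p x a x') =
        ∑' k : ℕ, ∑ a, M.γ ^ k * M.stateLaw π k x * (π.prob x a * M.p x a x') := fun x =>
      (Summable.tsum_finsetSum fun a _ => hs x a).symm
    simp only [h2]
    rw [← Summable.tsum_finsetSum fun x _ => summable_sum fun a _ => hs x a, ← tsum_mul_left]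
    refine tsum_congr fun k => ?_
    simp only [MDP.stateLaw, Finset.mul_sum, pow_succ]
    refine Finset.sum_congr rfl fun x _ => Finset.sum_congr rfl fun a _ => by ring
  simp only [M.occupancy_eq]
  rw [MDP.stateOcc, (M.summable_stateLaw π x').tsum_eq_zero_add, h1]
  simp only [MDP.stateOcc, MDP.stateLaw, pow_zero, one_mul, mul_add, Finset.mul_sum]
  congr 1
  refine Finset.sum_congr rfl fun x _ => Finset.sum_congr rfl fun a _ => by ring

theorem MDP.sum_stateOcc_mul (f : X → ℝ) :
    ∑ x, M.stateOcc π x * f x = (1 - M.γ) * f M.x₀ +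
      M.γ * ∑ x, ∑ a, M.occupancy π x a * ∑ x', M.p x a x' * f x' := by
  have h : ∀ x', M.stateOcc π x' * f x' = (1 - M.γ) * (if x' = M.x₀ then f x' else 0) +
      M.γ * ∑ x, ∑ a, M.occupancy π x a * (M.p x a x' * f x') := by
    intro x'
    rw [M.stateOcc_flow π x', add_mul, mul_assoc, mul_assoc, Finset.sum_mul]
    simp only [Finset.sum_mul, ite_mul, one_mul, zero_mul, mul_assoc]
  simp only [h, Finset.sum_add_distrib, ← Finset.mul_sum]
  congr 2
  · simp
  · rw [Finset.sum_comm]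
    refine Finset.sum_congr rfl fun x _ => ?_
    rw [Finset.sum_comm]
    simp only [Finset.mul_sum]

theorem MDP.ret_nonneg : 0 ≤ M.ret π :=
  Finset.sum_nonneg fun x _ => Finset.sum_nonneg fun a _ => by
    rw [M.occupancy_eq]
    exact mul_nonneg (mul_nonneg (M.stateOcc_nonneg π x) (π.nonneg x a)) (M.r_nonneg x a)

theorem MDP.ret_le_one : M.ret π ≤ 1 := by
  calc M.ret π ≤ ∑ x, ∑ a, M.stateOcc π x * π.prob x a :=
        Finset.sum_le_sum fun x _ => Finset.sum_le_sum fun a _ => by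
          rw [M.occupancy_eq]
          exact mul_le_of_le_one_right (mul_nonneg (M.stateOcc_nonneg π x) (π.nonneg x a))
            (M.r_le_one x a)
    _ = 1 := by simp only [← Finset.mul_sum, π.sum_one, mul_one, M.sum_stateOcc]

end Occupancy

/-- A weighted average of values in `[-b, b]` lies in `[-b, b]`. -/
theorem abs_sum_mul_le {ι : Type*} [Fintype ι] {p q : ι → ℝ} {b : ℝ} (hp : ∀ i, 0 ≤ p i)
    (h1 : ∑ i, p i = 1) (hq : ∀ i, |q i| ≤ b) : |∑ i, p i * q i| ≤ b := by
  calc |∑ i, p i * q i| ≤ ∑ i, |p i * q i| := Finset.abs_sum_le_sum_abs _ _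
    _ ≤ ∑ i, p i * b := Finset.sum_le_sum fun i _ => by
        rw [abs_mul, abs_of_nonneg (hp i)]
        exact mul_le_mul_of_nonneg_left (hq i) (hp i)
    _ = b := by rw [← Finset.sum_mul, h1, one_mul]

/-- The Bellman operator of a policy. -/
def MDP.bellman (M : MDP X A) (π : Policy X A) (v : X → ℝ) (x : X) : ℝ :=
  ∑ a, π.prob x a * (M.r x a + M.γ * ∑ x', M.p x a x' * v x')

/-- Averaging does not increase sup-norm distances, so discounting makes the operator a contraction.
-/
theorem MDP.exists_bellman_fixedPoint (M : MDP X A) (π : Policy X A) :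
    ∃ v, M.bellman π v = v := by
  have hc : ContractingWith ⟨M.γ, M.γ_pos.le⟩ (M.bellman π) := by
    refine ⟨M.γ_lt_one, LipschitzWith.of_dist_le_mul fun v w => ?_⟩
    refine (dist_pi_le_iff (mul_nonneg M.γ_pos.le dist_nonneg)).2 fun x => ?_
    have e : M.bellman π v x - M.bellman π w x =
        ∑ a, π.prob x a * (M.γ * ∑ x', M.p x a x' * (v x' - w x')) := by
      simp only [MDP.bellman, ← Finset.sum_sub_distrib, mul_sub]
      refine Finset.sum_congr rfl fun a _ => ?_
      rw [Finset.sum_sub_distrib]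
      ring
    rw [Real.dist_eq, e]
    refine abs_sum_mul_le (π.nonneg x) (π.sum_one x) fun a => ?_
    rw [abs_mul, abs_of_pos M.γ_pos]
    refine mul_le_mul_of_nonneg_left ?_ M.γ_pos.le
    refine abs_sum_mul_le (M.p_nonneg x a) (M.p_sum x a) fun x' => ?_
    rw [← Real.dist_eq]
    exact dist_le_pi_dist v w x'
  exact ⟨_, hc.fixedPoint_isFixedPt⟩

theorem MDP.abs_bellman_fixedPoint_le (M : MDP X A) (π : Policy X A) {v : X → ℝ}
    (hv : M.bellman π v = v) (x : X) : |v x| ≤ 1 / (1 - M.γ) := by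
  have hb : ∀ y, |v y| ≤ ‖v‖ := fun y => norm_le_pi_norm v y
  have h1 : ‖v‖ ≤ 1 + M.γ * ‖v‖ := by
    refine (pi_norm_le_iff_of_nonneg ?_).2 fun y => ?_
    · have := M.γ_pos; positivity
    · rw [Real.norm_eq_abs]
      nth_rw 1 [← hv]
      refine abs_sum_mul_le (π.nonneg y) (π.sum_one y) fun a => (abs_add_le _ _).trans ?_
      refine add_le_add (abs_le.2 ⟨?_, M.r_le_one y a⟩) ?_
      · linarith [M.r_nonneg y a]
      · rw [abs_mul, abs_of_pos M.γ_pos]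
        exact mul_le_mul_of_nonneg_left
          (abs_sum_mul_le (M.p_nonneg y a) (M.p_sum y a) hb) M.γ_pos.le
  refine (hb x).trans ?_
  rw [le_div_iff₀ (sub_pos.2 M.γ_lt_one)]
  linarith

/-- Test the flow equation against `v` and expand `v` by its Bellman equation on the left: the
discounted terms cancel. -/
theorem MDP.ret_eq_bellman_fixedPoint [DecidableEq X] (M : MDP X A) (π : Policy X A) {v : X → ℝ}
    (hv : M.bellman π v = v) : M.ret π = (1 - M.γ) * v M.x₀ := by
  have h1 := M.sum_stateOcc_mul π v
  have h2 : ∑ x, M.stateOcc π x * v x = M.ret π +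
      M.γ * ∑ x, ∑ a, M.occupancy π x a * ∑ x', M.p x a x' * v x' := by
    rw [MDP.ret, Finset.mul_sum, ← Finset.sum_add_distrib]
    refine Finset.sum_congr rfl fun x _ => ?_
    nth_rw 1 [← hv]
    rw [MDP.bellman, Finset.mul_sum, Finset.mul_sum, ← Finset.sum_add_distrib]
    refine Finset.sum_congr rfl fun a _ => ?_
    rw [M.occupancy_eq]; ring
  linarith

end MDPTheory

/-! ### Linear action-value functions. -/

section Linear

variable {X A : Type*} [Fintype X] {d : ℕ} {M : MDP X A} {φ : X → A → Fin d → ℝ} {ψ : X → Fin d → ℝ} {w : Fin d → ℝ} {R : ℝ}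

theorem MDP.IsLinear.sum_trans (hM : M.IsLinear φ ψ w R) (v : X → ℝ) (x : X) (a : A) :
    φ x a ⬝ᵥ ∑ x', v x' • ψ x' = ∑ x', M.p x a x' * v x' := by
  rw [dotProduct_sum]
  refine Finset.sum_congr rfl fun x' _ => ?_
  rw [dotProduct_smul, hM.trans_eq, smul_eq_mul, mul_comm]

theorem MDP.IsLinear.dim_pos [Nonempty A] (hM : M.IsLinear φ ψ w R) : 1 ≤ d := by
  rcases Nat.eq_zero_or_pos d with rfl | h
  · have := M.p_sum M.x₀ (Classical.arbitrary A)
    simp [hM.trans_eq] at this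
  · exact h

/-- In a linear MDP the action-value function of a policy is linear in the features. -/
theorem MDP.IsLinear.exists_value_weights [DecidableEq X] [Fintype A] (hM : M.IsLinear φ ψ w R)
    (π : Policy X A) : ∃ θ : Fin d → ℝ, l2norm θ ≤ √d / (1 - M.γ) ∧
      θ = w + M.γ • ∑ x, valueOf φ θ π x • ψ x ∧
      (∀ x, |valueOf φ θ π x| ≤ 1 / (1 - M.γ)) ∧ M.ret π = (1 - M.γ) * valueOf φ θ π M.x₀ := by
  obtain ⟨v, hv⟩ := M.exists_bellman_fixedPoint π
  have hγ := sub_pos.2 M.γ_lt_one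
  -- Linearity of rewards and transitions makes these weights reproduce the Bellman fixed point
  -- itself, which closes the self-referential equation for `θ`.
  have hval : valueOf φ (w + M.γ • ∑ x, v x • ψ x) π = v := by
    ext x
    nth_rw 2 [← hv]
    refine Finset.sum_congr rfl fun a _ => ?_
    rw [dotProduct_comm, dotProduct_add, dotProduct_smul, hM.sum_trans, hM.reward_eq, smul_eq_mul]
  refine ⟨w + M.γ • ∑ x, v x • ψ x, ?_, ?_, ?_, ?_⟩
  · refine (l2norm_add_le _ _).trans ?_
    rw [l2norm_smul, abs_of_pos M.γ_pos]
    have h1 := hM.norm_psi _ v (M.abs_bellman_fixedPoint_le π hv)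
    have h2 := mul_le_mul_of_nonneg_left h1 M.γ_pos.le
    have h3 := hM.norm_w
    have e : √(d : ℝ) / (1 - M.γ) = √d + M.γ * (1 / (1 - M.γ) * √d) := by
      field_simp; ring
    linarith
  · rw [hval]
  · rw [hval]; exact M.abs_bellman_fixedPoint_le π hv
  · rw [hval]; exact M.ret_eq_bellman_fixedPoint π hv

end Linear

theorem abs_valueOf_le {X A : Type*} [Fintype A] {d : ℕ} {φ : X → A → Fin d → ℝ} {R : ℝ}
    (hR : ∀ x a, l2norm (φ x a) ≤ R) {θ : Fin d → ℝ} {Dθ : ℝ}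
    (hθ : l2norm θ ≤ Dθ) (π : Policy X A) (x : X) : |valueOf φ θ π x| ≤ R * Dθ := by
  refine abs_sum_mul_le (π.nonneg x) (π.sum_one x) fun a => ?_
  rw [mul_comm R]
  exact (abs_dotProduct_le _ _).trans (mul_le_mul hθ (hR x a) (l2norm_nonneg _)
    ((l2norm_nonneg _).trans hθ))

/-! ### Exponential weights and stability of softmax policies. -/

section Hedge

/-- Hoeffding's lemma, with a suboptimal constant, for a finite probability vector. -/
theorem sum_mul_exp_le {ι : Type*} [Fintype ι] {p q : ι → ℝ} {b : ℝ} (hp : ∀ i, 0 ≤ p i)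
    (h1 : ∑ i, p i = 1) (hq : ∀ i, |q i| ≤ b) (s : ℝ) :
    ∑ i, p i * Real.exp (s * (q i - ∑ j, p j * q j)) ≤ Real.exp (2 * (s * b) ^ 2) := by
  set m := ∑ j, p j * q j with hm
  have hmb : |m| ≤ b := abs_sum_mul_le hp h1 hq
  rcases eq_or_ne b 0 with rfl | hb0
  · have : ∀ i, q i - m = 0 := fun i => by
      rw [abs_nonpos_iff.1 (hq i), abs_nonpos_iff.1 hmb, sub_zero]
    simp [this, h1]
  have hb : 0 < b := lt_of_le_of_ne ((abs_nonneg _).trans hmb) (Ne.symm hb0)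
  -- The chord is taken over `[-2b, 2b]`, which contains every `q i - m`; this symmetric interval
  -- gives the constant 2 instead of the sharp 1/2.
  have hchord : ∀ i, Real.exp (s * (q i - m)) ≤
      Real.cosh (2 * s * b) + (q i - m) * (Real.sinh (2 * s * b) / (2 * b)) := by
    intro i
    have h := abs_le.1 (hq i)
    have h' := abs_le.1 hmb
    have w1 : 0 ≤ (2 * b + (q i - m)) / (4 * b) := div_nonneg (by linarith) (by linarith)
    have w2 : 0 ≤ (2 * b - (q i - m)) / (4 * b) := div_nonneg (by linarith) (by linarith)
    have hc := convexOn_exp.2 (Set.mem_univ (2 * s * b)) (Set.mem_univ (-(2 * s * b))) w1 w2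
      (by field_simp; ring)
    simp only [smul_eq_mul] at hc
    have e : (2 * b + (q i - m)) / (4 * b) * (2 * s * b) +
        (2 * b - (q i - m)) / (4 * b) * (-(2 * s * b)) = s * (q i - m) := by
      field_simp; ring
    rw [e] at hc
    refine hc.trans (le_of_eq ?_)
    rw [Real.cosh_eq, Real.sinh_eq]
    field_simp; ring
  calc ∑ i, p i * Real.exp (s * (q i - m))
      ≤ ∑ i, p i * (Real.cosh (2 * s * b) + (q i - m) * (Real.sinh (2 * s * b) / (2 * b))) :=
        Finset.sum_le_sum fun i _ => mul_le_mul_of_nonneg_left (hchord i) (hp i)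
    _ = Real.cosh (2 * s * b) := by
        have : ∑ i, p i * (q i - m) = 0 := by
          simp only [mul_sub, Finset.sum_sub_distrib, ← Finset.sum_mul, h1, ← hm]; ring
        simp only [mul_add, ← mul_assoc, Finset.sum_add_distrib, ← Finset.sum_mul, h1, this]
        ring
    _ ≤ Real.exp ((2 * s * b) ^ 2 / 2) := Real.cosh_le_exp_half_sq _
    _ = Real.exp (2 * (s * b) ^ 2) := by ring_nf

variable {A : Type*} [Fintype A] [Nonempty A]

/-- Regret of exponential weights against a fixed distribution `p`. -/
theorem exponentialWeights_regret {α b : ℝ} (hα : 0 < α) (T : ℕ) (q : ℕ → A → ℝ)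
    (hq : ∀ t ∈ Finset.Icc 1 T, ∀ a, |q t a| ≤ b) (ρ : ℕ → A → ℝ)
    (hρ : ∀ t < T, ∀ a, ρ (t + 1) a = Real.exp (α * ∑ k ∈ Finset.Icc 1 t, q k a) /
      ∑ c, Real.exp (α * ∑ k ∈ Finset.Icc 1 t, q k c))
    (p : A → ℝ) (hp : ∀ a, 0 ≤ p a) (hp1 : ∑ a, p a = 1) :
    ∑ t ∈ Finset.Icc 1 T, (∑ a, p a * q t a - ∑ a, ρ t a * q t a) ≤
      Real.log (Fintype.card A) / α + T * (2 * α * b ^ 2) := by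
  have hpos : ∀ t, 0 < ∑ c, Real.exp (α * ∑ k ∈ Finset.Icc 1 t, q k c) := fun t =>
    Finset.sum_pos (fun _ _ => Real.exp_pos _) Finset.univ_nonempty
  -- Potential argument: one round raises the log of the total weight by at most `α` times the mean
  -- payoff plus the Hoeffding term.
  have key : ∀ t ≤ T, Real.log (∑ c, Real.exp (α * ∑ k ∈ Finset.Icc 1 t, q k c)) ≤
      Real.log (Fintype.card A) + α * ∑ k ∈ Finset.Icc 1 t, ∑ a, ρ k a * q k a +
        t * (2 * (α * b) ^ 2) := by
    intro t
    induction t with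
    | zero => intro _; simp
    | succ t ih =>
      intro ht
      have ih := ih (by omega)
      set S := ∑ c, Real.exp (α * ∑ k ∈ Finset.Icc 1 t, q k c) with hS
      set m := ∑ a, ρ (t + 1) a * q (t + 1) a with hm
      have hr := hρ t (by omega)
      have hr1 : ∑ a, ρ (t + 1) a = 1 := by
        simp only [hr, ← Finset.sum_div]; exact div_self (hpos t).ne'
      have hr0 : ∀ a, 0 ≤ ρ (t + 1) a := fun a => by
        rw [hr]; exact div_nonneg (Real.exp_pos _).le (hpos t).le
      have hoeff := sum_mul_exp_le hr0 hr1 (hq (t + 1) (by simp; omega)) α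
      rw [← hm] at hoeff
      have e : ∑ c, Real.exp (α * ∑ k ∈ Finset.Icc 1 (t + 1), q k c) =
          S * Real.exp (α * m) * ∑ a, ρ (t + 1) a * Real.exp (α * (q (t + 1) a - m)) := by
        rw [Finset.mul_sum]
        refine Finset.sum_congr rfl fun a _ => ?_
        rw [Finset.sum_Icc_succ_top (by omega), hr, ← hS, mul_sub, Real.exp_sub, mul_add, Real.exp_add]
        have : S ≠ 0 := (hpos t).ne'
        have := (Real.exp_pos (α * m)).ne'
        field_simp
      have le : ∑ c, Real.exp (α * ∑ k ∈ Finset.Icc 1 (t + 1), q k c) ≤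
          S * Real.exp (α * m) * Real.exp (2 * (α * b) ^ 2) := by
        rw [e]
        exact mul_le_mul_of_nonneg_left hoeff (mul_nonneg (hpos t).le (Real.exp_pos _).le)
      have := Real.log_le_log (hpos (t + 1)) le
      rw [mul_assoc, ← Real.exp_add, Real.log_mul (hpos t).ne' (Real.exp_pos _).ne',
        Real.log_exp] at this
      rw [Finset.sum_Icc_succ_top (by omega), ← hm]
      push_cast
      linarith
  have k := key T le_rfl
  have low : ∀ a, α * ∑ k ∈ Finset.Icc 1 T, q k a ≤
      Real.log (∑ c, Real.exp (α * ∑ k ∈ Finset.Icc 1 T, q k c)) := fun a => by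
    rw [Real.le_log_iff_exp_le (hpos T)]
    exact Finset.single_le_sum (f := fun c => Real.exp (α * ∑ k ∈ Finset.Icc 1 T, q k c))
      (fun c _ => (Real.exp_pos _).le) (Finset.mem_univ a)
  have low' : α * ∑ t ∈ Finset.Icc 1 T, ∑ a, p a * q t a ≤
      Real.log (∑ c, Real.exp (α * ∑ k ∈ Finset.Icc 1 T, q k c)) := by
    have e : α * ∑ t ∈ Finset.Icc 1 T, ∑ a, p a * q t a =
        ∑ a, p a * (α * ∑ k ∈ Finset.Icc 1 T, q k a) := by
      rw [Finset.sum_comm, Finset.mul_sum]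
      refine Finset.sum_congr rfl fun a _ => ?_
      rw [← Finset.mul_sum]; ring
    rw [e]
    calc _ ≤ ∑ a, p a * Real.log (∑ c, Real.exp (α * ∑ k ∈ Finset.Icc 1 T, q k c)) :=
          Finset.sum_le_sum fun a _ => mul_le_mul_of_nonneg_left (low a) (hp a)
      _ = _ := by rw [← Finset.sum_mul, hp1, one_mul]
  refine le_of_mul_le_mul_left ?_ hα
  rw [Finset.sum_sub_distrib, mul_sub, mul_add, mul_div_cancel₀ _ hα.ne']
  linarith

variable {X : Type*} {d : ℕ} (φ : X → A → Fin d → ℝ)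

theorem uniformPolicy_eq_softmaxPolicy : uniformPolicy X A = softmaxPolicy φ 0 := by
  ext x a
  simp [uniformPolicy, softmaxPolicy]

/-- Numerator and normalizer each change by a factor of at most e^κ. -/
theorem softmaxPolicy_prob_le {ϑ ϑ' : Fin d → ℝ} {κ : ℝ}
    (h : ∀ x a, |φ x a ⬝ᵥ (ϑ - ϑ')| ≤ κ) (x : X) (a : A) :
    (softmaxPolicy φ ϑ).prob x a ≤ Real.exp (2 * κ) * (softmaxPolicy φ ϑ').prob x a := by
  have h1 : ∀ a, φ x a ⬝ᵥ ϑ ≤ κ + φ x a ⬝ᵥ ϑ' := fun a => by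
    have := (abs_le.1 (h x a)).2
    rw [dotProduct_sub] at this; linarith
  have h2 : ∀ a, φ x a ⬝ᵥ ϑ' ≤ κ + φ x a ⬝ᵥ ϑ := fun a => by
    have := (abs_le.1 (h x a)).1
    rw [dotProduct_sub] at this; linarith
  have hS : ∑ b, Real.exp (φ x b ⬝ᵥ ϑ') ≤ Real.exp κ * ∑ b, Real.exp (φ x b ⬝ᵥ ϑ) := by
    rw [Finset.mul_sum]
    refine Finset.sum_le_sum fun b _ => ?_
    rw [← Real.exp_add]
    exact Real.exp_le_exp.2 (h2 b)
  have hpos : ∀ ζ : Fin d → ℝ, 0 < ∑ b, Real.exp (φ x b ⬝ᵥ ζ) := fun ζ =>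
    Finset.sum_pos (fun _ _ => Real.exp_pos _) Finset.univ_nonempty
  simp only [softmaxPolicy]
  rw [← mul_div_assoc, div_le_div_iff₀ (hpos _) (hpos _)]
  calc _ ≤ Real.exp (κ + φ x a ⬝ᵥ ϑ') * (Real.exp κ * ∑ b, Real.exp (φ x b ⬝ᵥ ϑ)) :=
        mul_le_mul (Real.exp_le_exp.2 (h1 a)) hS (hpos _).le (Real.exp_pos _).le
    _ = _ := by rw [Real.exp_add, two_mul, Real.exp_add]; ring

/-- Stability of the softmax policy in its parameter, in total variation. -/
theorem sum_abs_softmaxPolicy_sub_le {ϑ ϑ' : Fin d → ℝ} {κ : ℝ} (hκ0 : 0 ≤ κ) (hκ : κ ≤ 1 / 2)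
    (h : ∀ x a, |φ x a ⬝ᵥ (ϑ - ϑ')| ≤ κ) (x : X) :
    ∑ a, |(softmaxPolicy φ ϑ).prob x a - (softmaxPolicy φ ϑ').prob x a| ≤ 8 * κ := by
  have h' : ∀ x a, |φ x a ⬝ᵥ (ϑ' - ϑ)| ≤ κ := fun x a => by
    rw [← neg_sub, dotProduct_neg, abs_neg]; exact h x a
  have he : Real.exp (2 * κ) ≤ 1 + 4 * κ := by
    have := Real.abs_exp_sub_one_le (x := 2 * κ) (by rw [abs_of_nonneg] <;> linarith)
    rw [abs_of_nonneg (by linarith : 0 ≤ 2 * κ)] at this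
    linarith [(abs_le.1 this).2]
  calc _ ≤ ∑ a, 4 * κ * ((softmaxPolicy φ ϑ).prob x a + (softmaxPolicy φ ϑ').prob x a) := by
        refine Finset.sum_le_sum fun a _ => ?_
        have n1 := (softmaxPolicy φ ϑ).nonneg x a
        have n2 := (softmaxPolicy φ ϑ').nonneg x a
        have l1 := softmaxPolicy_prob_le φ h x a
        have l2 := softmaxPolicy_prob_le φ h' x a
        have m1 := mul_le_mul_of_nonneg_right he n1
        have m2 := mul_le_mul_of_nonneg_right he n2
        have m3 := mul_nonneg hκ0 n1
        have m4 := mul_nonneg hκ0 n2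
        rw [abs_le]; constructor <;> linarith
    _ = 8 * κ := by
        rw [← Finset.mul_sum, Finset.sum_add_distrib, Policy.sum_one, Policy.sum_one]; ring

/-- Change the policy first, with `θ` fixed, and then the weights. The modulus does not depend on
the number of actions, so a net of parameters is a net of value functions. -/
theorem abs_valueOf_sub_le {R Dθ κ τ : ℝ} (hR : ∀ x a, l2norm (φ x a) ≤ R)
    {θ θ' ϑ ϑ' : Fin d → ℝ} (hθ : l2norm θ ≤ Dθ) (hκ0 : 0 ≤ κ) (hκ : κ ≤ 1 / 2)
    (h : ∀ x a, |φ x a ⬝ᵥ (ϑ - ϑ')| ≤ κ) (h' : ∀ x a, |φ x a ⬝ᵥ (θ - θ')| ≤ τ) (x : X) :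
    |valueOf φ θ (softmaxPolicy φ ϑ) x - valueOf φ θ' (softmaxPolicy φ ϑ') x| ≤
      8 * κ * (R * Dθ) + τ := by
  have e : valueOf φ θ (softmaxPolicy φ ϑ) x - valueOf φ θ' (softmaxPolicy φ ϑ') x =
      ∑ a, ((softmaxPolicy φ ϑ).prob x a - (softmaxPolicy φ ϑ').prob x a) * (θ ⬝ᵥ φ x a) +
      ∑ a, (softmaxPolicy φ ϑ').prob x a * (φ x a ⬝ᵥ (θ - θ')) := by
    simp only [valueOf, ← Finset.sum_sub_distrib, ← Finset.sum_add_distrib,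
      dotProduct_comm (φ x _), sub_dotProduct]
    refine Finset.sum_congr rfl fun a _ => by ring
  rw [e]
  refine (abs_add_le _ _).trans (add_le_add ?_ ?_)
  · have hb : ∀ a, |θ ⬝ᵥ φ x a| ≤ R * Dθ := fun a => by
      rw [mul_comm R]
      exact (abs_dotProduct_le _ _).trans (mul_le_mul hθ (hR x a) (l2norm_nonneg _)
        ((l2norm_nonneg _).trans hθ))
    have h0 : 0 ≤ R * Dθ := (abs_nonneg _).trans (hb (Classical.arbitrary A))
    refine (Finset.abs_sum_le_sum_abs _ _).trans ?_
    refine (Finset.sum_le_sum fun a _ => ?_).trans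
      (le_of_eq_of_le (Finset.sum_mul _ _ (R * Dθ)).symm
        (mul_le_mul_of_nonneg_right (sum_abs_softmaxPolicy_sub_le φ hκ0 hκ h x) h0))
    rw [abs_mul]
    exact mul_le_mul_of_nonneg_left (hb a) (abs_nonneg _)
  · exact abs_sum_mul_le (Policy.nonneg _ x) (Policy.sum_one _ x) fun a => h' x a

end Hedge

/-! ### Exponential supermartingales for the data and the union bound. -/

section Concentration

/-- The relevant part `(X_i, A_i, X'_i)` of a record. -/
def Sample.triple {X A : Type*} (s : Sample X A) : X × A × X := (s.state, s.action, s.next)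

variable {X A Ω : Type*} [Fintype X] [MeasurableSpace Ω]

/-- Decomposition of the probability of an event over the values of a finite-valued function. -/
theorem real_eq_sum_fiber {P : Measure Ω} [IsFiniteMeasure P] {Z : Type*} [Fintype Z] (f : Ω → Z)
    (hf : ∀ z, MeasurableSet {ω | f ω = z}) (s : Set Ω) :
    P.real s = ∑ z, P.real {ω | ω ∈ s ∧ f ω = z} := by
  have h := sum_measureReal_preimage_singleton (μ := P.restrict s) Finset.univ (f := f)
    (fun z _ => hf z)
  simp only [Finset.coe_univ, Set.preimage_univ, measureReal_restrict_apply_univ] at h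
  rw [← h]
  refine Finset.sum_congr rfl fun z _ => ?_
  rw [measureReal_restrict_apply (show MeasurableSet (f ⁻¹' {z}) from hf z), Set.inter_comm]
  rfl

variable {M : MDP X A} {P : Measure Ω} {n : ℕ} {D : Ω → Fin n → Sample X A}

theorem IsOfflineData.measurableSet_triple (hD : IsOfflineData M P D) (i : Fin n)
    (z : X × A × X) : MeasurableSet {ω | (D ω i).triple = z} := by
  convert hD.measurable i z.1 z.2.1 z.2.2 using 4
  simp [Sample.triple, Prod.ext_iff]

theorem IsOfflineData.measurableSet_pair (hD : IsOfflineData M P D) (i : Fin n) (z : X × A) :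
    MeasurableSet {ω | ((D ω i).state, (D ω i).action) = z} := by
  have : {ω | ((D ω i).state, (D ω i).action) = z} =
      ⋃ x', {ω | (D ω i).triple = (z.1, z.2, x')} := by
    ext ω
    simp [Sample.triple, Prod.ext_iff]
  rw [this]
  exact MeasurableSet.iUnion fun x' => hD.measurableSet_triple i _

theorem IsOfflineData.measurableSet_history (hD : IsOfflineData M P D)
    (h : Fin n → X × A × X) :
    MeasurableSet {ω | (fun i => (D ω i).triple) = h} := by
  have : {ω | (fun i => (D ω i).triple) = h} = ⋂ i, {ω | (D ω i).triple = h i} := by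
    ext ω
    simp [funext_iff]
  rw [this]
  exact MeasurableSet.iInter fun j => hD.measurableSet_triple _ _

theorem IsOfflineData.real_prefix_succ (hD : IsOfflineData M P D) {k : ℕ} (hk : k < n)
    (h : Fin k → X × A × X) (x : X) (a : A) (x' : X) :
    P.real {ω | ∀ j : Fin (k + 1), (D ω (Fin.castLE hk j)).triple =
        (Fin.snoc h (x, a, x') : Fin (k + 1) → X × A × X) j} =
      P.real {ω | ω ∈ {ω | ∀ j : Fin k, (D ω (Fin.castLE hk.le j)).triple = h j} ∧
        ((D ω ⟨k, hk⟩).state, (D ω ⟨k, hk⟩).action) = (x, a)} * M.p x a x' := by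
  -- `next_law` takes a history of full length. The default `(x, a, x')` supplies record `k`, and
  -- later entries are never read.
  have key := hD.next_law ⟨k, hk⟩ (fun j => if hj : j.1 < k then h ⟨j, hj⟩ else (x, a, x'))
  simp only [lt_irrefl, dite_false] at key
  have e : ∀ ω, (∀ j < (⟨k, hk⟩ : Fin n), ((D ω j).state, (D ω j).action, (D ω j).next) =
      if hj : j.1 < k then h ⟨j, hj⟩ else (x, a, x')) ↔
      ∀ j : Fin k, (D ω (Fin.castLE hk.le j)).triple = h j := by
    intro ω
    constructor
    · intro H j
      have := H (Fin.castLE hk.le j) (by simp [Fin.lt_def])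
      simpa [Sample.triple] using this
    · intro H j hj
      have hj' : j.1 < k := hj
      rw [dif_pos hj']
      exact H ⟨j, hj'⟩
  simp only [e] at key
  convert key using 3
  · ext ω
    simp only [Fin.forall_fin_succ', Fin.snoc_castSucc, Fin.snoc_last]
    refine and_congr Iff.rfl ?_
    simp only [Sample.triple, Prod.ext_iff]
    rfl
  · ext ω
    simp [Prod.ext_iff]

variable [Fintype A]

/-- A product of conditionally sub-normalized weights has expectation at most one. -/
theorem IsOfflineData.sum_prefix_le [IsProbabilityMeasure P] (hD : IsOfflineData M P D)
    {W : X × A × X → ℝ} (hW : ∀ z, 0 ≤ W z) (hW1 : ∀ x a, ∑ x', M.p x a x' * W (x, a, x') ≤ 1)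
    {k : ℕ} (hk : k ≤ n) :
    ∑ h : Fin k → X × A × X,
      P.real {ω | ∀ j, (D ω (Fin.castLE hk j)).triple = h j} * ∏ j, W (h j) ≤ 1 := by
  induction k with
  | zero => simp
  | succ k ih =>
    refine le_trans ?_ (ih (by omega))
    rw [← (Fin.snocEquiv fun _ => X × A × X).sum_comp, Fintype.sum_prod_type, Finset.sum_comm]
    refine Finset.sum_le_sum fun h _ => ?_
    simp only [Fin.snocEquiv_apply, Fin.prod_univ_castSucc, Fin.snoc_castSucc, Fin.snoc_last,
      Fintype.sum_prod_type, hD.real_prefix_succ hk]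
    have hpr : 0 ≤ ∏ j, W (h j) := Finset.prod_nonneg fun j _ => hW _
    -- Nothing is known about the law of the pair given the past, so the prefix event is split over
    -- the pairs and the weight is averaged over the next state for each pair separately.
    rw [real_eq_sum_fiber (fun ω => ((D ω ⟨k, hk⟩).state, (D ω ⟨k, hk⟩).action))
      (hD.measurableSet_pair _) {ω | ∀ j, (D ω (Fin.castLE _ j)).triple = h j},
      Fintype.sum_prod_type, Finset.sum_mul]
    refine Finset.sum_le_sum fun x _ => ?_
    rw [Finset.sum_mul]
    refine Finset.sum_le_sum fun a _ => ?_
    refine le_trans (le_of_eq ?_) (mul_le_of_le_one_right (mul_nonneg measureReal_nonneg hpr)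
      (hW1 x a))
    rw [Finset.mul_sum]
    refine Finset.sum_congr rfl fun x' _ => ?_
    ring

/-- Markov's inequality for products of conditionally sub-normalized weights. -/
theorem IsOfflineData.real_prod_gt_le [IsProbabilityMeasure P] (hD : IsOfflineData M P D)
    {W : X × A × X → ℝ} (hW : ∀ z, 0 ≤ W z) (hW1 : ∀ x a, ∑ x', M.p x a x' * W (x, a, x') ≤ 1)
    {c : ℝ} (hc : 0 < c) : P.real {ω | c < ∏ i, W (D ω i).triple} ≤ 1 / c := by
  classical
  rw [le_div_iff₀ hc, real_eq_sum_fiber (fun ω i => (D ω i).triple) hD.measurableSet_history,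
    Finset.sum_mul]
  refine le_trans (Finset.sum_le_sum fun h _ => ?_) (hD.sum_prefix_le hW hW1 le_rfl)
  have hpr : 0 ≤ ∏ j, W (h j) := Finset.prod_nonneg fun j _ => hW _
  by_cases hh : c < ∏ j, W (h j)
  · refine mul_le_mul (measureReal_mono ?_) hh.le hc.le measureReal_nonneg
    rintro ω ⟨-, hω⟩ j
    exact congrFun hω j
  · have : {ω | ω ∈ {ω | c < ∏ i, W (D ω i).triple} ∧ (fun i => (D ω i).triple) = h} = ∅ := by
      ext ω
      simp only [Set.mem_ofPred_eq, Set.mem_empty_iff_false, iff_false, not_and]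
      rintro h1 rfl
      exact hh h1
    rw [this, measureReal_empty, zero_mul]
    exact mul_nonneg measureReal_nonneg hpr

/-- The deviation of `v(x')` from its conditional expectation. -/
def MDP.noise (M : MDP X A) (v : X → ℝ) (x : X) (a : A) (x' : X) : ℝ :=
  v x' - ∑ y, M.p x a y * v y

/-- Exponential concentration for weighted sums of the noise, uniformly over a finite family. -/
theorem IsOfflineData.one_sub_le_real [IsProbabilityMeasure P] (hD : IsOfflineData M P D)
    {ι : Type*} (N : Finset ι) (v : ι → X → ℝ) (hv : ∀ j x, |v j x| ≤ 1) (u : ι → X → A → ℝ)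
    {δ : ℝ} (hδ : 0 < δ) :
    1 - δ ≤ P.real {ω | ∀ j ∈ N, ∑ i, (u j (D ω i).state (D ω i).action *
        M.noise (v j) (D ω i).state (D ω i).action (D ω i).next -
        2 * u j (D ω i).state (D ω i).action ^ 2) ≤ Real.log (N.card / δ)} := by
  classical
  rcases N.eq_empty_or_nonempty with rfl | hN
  · simp [hδ.le]
  have hN' : (0 : ℝ) < N.card := by exact_mod_cast hN.card_pos
  -- The compensator `2 u²` is the exponent in `sum_mul_exp_le` with `b = 1`, so `exp (F j)` has
  -- conditional mean at most one.
  set F : ι → X × A × X → ℝ := fun j z =>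
    u j z.1 z.2.1 * M.noise (v j) z.1 z.2.1 z.2.2 - 2 * u j z.1 z.2.1 ^ 2 with hF
  have bad : ∀ j, P.real {ω | Real.log (N.card / δ) < ∑ i, F j (D ω i).triple} ≤ δ / N.card := by
    intro j
    have h := hD.real_prod_gt_le (W := fun z => Real.exp (F j z)) (fun z => (Real.exp_pos _).le)
      (fun x a => ?_) (c := N.card / δ) (by positivity)
    · rw [one_div_div] at h
      convert h using 4 with ω
      rw [← Real.exp_sum, Real.log_lt_iff_lt_exp (by positivity)]
    · have := sum_mul_exp_le (M.p_nonneg x a) (M.p_sum x a) (hv j) (u j x a)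
      simp only [hF, MDP.noise, Real.exp_sub]
      simp only [← mul_div_assoc, ← Finset.sum_div]
      rw [div_le_one (Real.exp_pos _)]
      simpa using this
  have hm : ∀ j, MeasurableSet {ω | Real.log (N.card / δ) < ∑ i, F j (D ω i).triple} := by
    intro j
    have : {ω | Real.log (N.card / δ) < ∑ i, F j (D ω i).triple} =
        ⋃ h ∈ {h : Fin n → X × A × X | Real.log (N.card / δ) < ∑ i, F j (h i)},
          {ω | (fun i => (D ω i).triple) = h} := by
      ext ω
      simp
    rw [this]
    exact MeasurableSet.biUnion (Set.to_countable _) fun h _ => hD.measurableSet_history h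
  have hU := measureReal_biUnion_finset_le (μ := P) N
    fun j => {ω | Real.log (N.card / δ) < ∑ i, F j (D ω i).triple}
  have hU' : P.real (⋃ j ∈ N, {ω | Real.log (N.card / δ) < ∑ i, F j (D ω i).triple}) ≤ δ := by
    refine hU.trans ((Finset.sum_le_sum fun j _ => bad j).trans (le_of_eq ?_))
    rw [Finset.sum_const, nsmul_eq_mul, mul_div_cancel₀ _ hN'.ne']
  have hc := measureReal_compl (μ := P) (Finset.measurableSet_biUnion N fun j _ => hm j)
  rw [probReal_univ] at hc
  refine le_trans (by rw [hc]; linarith) (measureReal_mono ?_)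
  intro ω hω j hj
  simp only [Set.mem_compl_iff, Set.mem_iUnion, Set.mem_ofPred_eq, not_exists, not_lt] at hω
  exact hω j hj

end Concentration

/-! ### Grids and truncation. -/

section Net

/-- A grid of mesh `1 / K` in the cube of half-width `K`. -/
def gridNet (d K : ℕ) : Finset (Fin d → ℝ) :=
  Fintype.piFinset fun _ => (Finset.Icc (-(K : ℤ) ^ 2) ((K : ℤ) ^ 2)).image fun m : ℤ => (m : ℝ) / K

theorem card_gridNet_le (d K : ℕ) : (gridNet d K).card ≤ (2 * K ^ 2 + 1) ^ d := by
  rw [gridNet, Fintype.card_piFinset, Finset.prod_const, Finset.card_univ, Fintype.card_fin]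
  refine Nat.pow_le_pow_left (Finset.card_image_le.trans ?_) d
  rw [Int.card_Icc]
  zify
  rw [Int.toNat_of_nonneg (by linarith [sq_nonneg (K : ℤ)])]
  linarith

theorem exists_mem_gridNet {d K : ℕ} (hK : 0 < K) {x : Fin d → ℝ} (hx : ∀ j, |x j| ≤ K) :
    ∃ y ∈ gridNet d K, ∀ j, |(x - y) j| ≤ 1 / K := by
  have hK' : (0 : ℝ) < K := by exact_mod_cast hK
  refine ⟨fun j => (⌊x j * K⌋ : ℝ) / K, ?_, fun j => ?_⟩
  · refine Fintype.mem_piFinset.2 fun j => Finset.mem_image_of_mem _ ?_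
    have h := abs_le.1 (hx j)
    rw [Finset.mem_Icc]
    constructor
    · rw [Int.le_floor]; push_cast; nlinarith
    · rw [← Int.cast_le (R := ℝ)]
      refine (Int.floor_le _).trans ?_
      push_cast; nlinarith
  · have e : (x - fun j => (⌊x j * K⌋ : ℝ) / K) j = (x j * K - ⌊x j * K⌋) / K := by
      simp only [Pi.sub_apply]; field_simp
    rw [e, abs_div, abs_of_pos hK', Int.self_sub_floor, abs_of_nonneg (Int.fract_nonneg _)]
    exact div_le_div_of_nonneg_right (Int.fract_lt_one _).le hK'.le

theorem abs_dotProduct_le_of_grid {d K : ℕ} {R : ℝ} {f e : Fin d → ℝ} (hf : l2norm f ≤ R)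
    (he : ∀ j, |e j| ≤ 1 / K) : |f ⬝ᵥ e| ≤ R * d / K := by
  refine (abs_dotProduct_le _ _).trans ?_
  rw [mul_div_assoc, div_eq_mul_one_div (d : ℝ)]
  exact mul_le_mul hf (l2norm_le_of_abs_le he) (l2norm_nonneg _) ((l2norm_nonneg _).trans hf)

/-- Truncation to `[-1, 1]`. -/
def clip (t : ℝ) : ℝ := max (-1) (min 1 t)

theorem abs_clip_le (t : ℝ) : |clip t| ≤ 1 :=
  abs_le.2 ⟨le_max_left _ _, max_le (by norm_num) (min_le_left _ _)⟩

theorem clip_of_abs_le {t : ℝ} (h : |t| ≤ 1) : clip t = t := by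
  rw [clip, min_eq_right (abs_le.1 h).2, max_eq_right (abs_le.1 h).1]

theorem abs_clip_sub_clip_le (s t : ℝ) : |clip s - clip t| ≤ |s - t| := by
  refine (abs_max_sub_max_le_max _ _ _ _).trans (max_le (by simp) ?_)
  exact (abs_min_sub_min_le_max _ _ _ _).trans (max_le (by simp) le_rfl)

end Net

/-! ### Self-normalized control of the transition error. -/

section Noise

variable {X A : Type*} [Fintype X] {d n : ℕ} {M : MDP X A}

theorem MDP.noise_sub (v w : X → ℝ) (x : X) (a : A) (x' : X) :
    M.noise (v - w) x a x' = M.noise v x a x' - M.noise w x a x' := by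
  simp only [MDP.noise, Pi.sub_apply, mul_sub, Finset.sum_sub_distrib]; ring

theorem MDP.noise_smul (c : ℝ) (v : X → ℝ) (x : X) (a : A) (x' : X) :
    M.noise (c • v) x a x' = c * M.noise v x a x' := by
  simp only [MDP.noise, Pi.smul_apply, smul_eq_mul, mul_sub, Finset.mul_sum]
  congr 1
  exact Finset.sum_congr rfl fun y _ => by ring

theorem MDP.abs_noise_le {v : X → ℝ} {b : ℝ} (hv : ∀ x, |v x| ≤ b) (x : X) (a : A) (x' : X) :
    |M.noise v x a x'| ≤ 2 * b := by
  refine (abs_sub _ _).trans ?_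
  linarith [hv x', abs_sum_mul_le (M.p_nonneg x a) (M.p_sum x a) hv]

variable (M) (φ : X → A → Fin d → ℝ) (β : ℝ) (D : Fin n → Sample X A)

/-- The deviation of record `i` from its conditional expectation. -/
def sampleNoise (v : X → ℝ) (i : Fin n) : ℝ := M.noise v (D i).state (D i).action (D i).next

/-- The least-squares fit to the noise. -/
def noiseFit (v : X → ℝ) : Fin d → ℝ :=
  (covMatrix φ β D)⁻¹ *ᵥ ((n : ℝ)⁻¹ • ∑ i, sampleNoise M D v i • (D i).feat φ)

theorem noiseFit_sub (v w : X → ℝ) :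
    noiseFit M φ β D (v - w) = noiseFit M φ β D v - noiseFit M φ β D w := by
  simp only [noiseFit, sampleNoise, MDP.noise_sub, sub_smul, Finset.sum_sub_distrib, smul_sub,
    mulVec_sub]

theorem noiseFit_smul (c : ℝ) (v : X → ℝ) :
    noiseFit M φ β D (c • v) = c • noiseFit M φ β D v := by
  simp only [noiseFit, sampleNoise, MDP.noise_smul, mul_smul, ← Finset.smul_sum, smul_comm _ c,
    mulVec_smul]

variable {M φ β D}

theorem covMatrix_mulVec_noiseFit (hβ : 0 < β) (v : X → ℝ) :
    covMatrix φ β D *ᵥ noiseFit M φ β D v =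
      (n : ℝ)⁻¹ • ∑ i, sampleNoise M D v i • (D i).feat φ :=
  covMatrix_mulVec_inv φ D hβ _

/-- A deterministic bound. It confines the random fit to the grid's cube and controls the
discretization remainder. -/
theorem covForm_noiseFit_le (hβ : 0 < β) (hn : 1 ≤ n) {v : X → ℝ} {b : ℝ} (hv : ∀ x, |v x| ≤ b) :
    covForm φ β D (noiseFit M φ β D v) (noiseFit M φ β D v) ≤ 4 * b ^ 2 := by
  have hn' : (0 : ℝ) < n := by exact_mod_cast hn
  refine (covForm_leastSquares_le φ D hβ _ _ (covMatrix_mulVec_noiseFit hβ v)).trans ?_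
  have : ∑ i, sampleNoise M D v i ^ 2 ≤ ∑ _i : Fin n, (2 * b) ^ 2 := Finset.sum_le_sum fun i _ => by
    rw [← sq_abs]
    exact pow_le_pow_left₀ (abs_nonneg _) (M.abs_noise_le hv _ _ _) 2
  simp only [Finset.sum_const, Finset.card_univ, Fintype.card_fin, nsmul_eq_mul] at this
  rw [inv_mul_le_iff₀ hn']
  linarith

/-- Exponential concentration along a net of directions controls the self-normalized noise. -/
theorem covForm_noiseFit_le_of_net (hβ : 0 < β) (hn : 1 ≤ n) {R ℓ : ℝ} {K : ℕ} (hK : 0 < K)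
    (hR : ∀ x a, l2norm (φ x a) ≤ R) (hK1 : n * (R * d) ≤ K) (hK2 : 4 / β ≤ (K : ℝ) ^ 2)
    {v : X → ℝ} (hv : ∀ x, |v x| ≤ 1)
    (hℓ : ∀ u ∈ gridNet d K,
      ∑ i, ((D i).feat φ ⬝ᵥ u * sampleNoise M D v i - 2 * ((D i).feat φ ⬝ᵥ u) ^ 2) ≤ ℓ) :
    covForm φ β D (noiseFit M φ β D v) (noiseFit M φ β D v) ≤ 16 * (ℓ + 6) / n := by
  have hn' : (1 : ℝ) ≤ n := by exact_mod_cast hn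
  have hK' : (0 : ℝ) < K := by exact_mod_cast hK
  set y := noiseFit M φ β D v with hy
  set q := covForm φ β D y y with hq
  have hq4 : q ≤ 4 := by simpa using covForm_noiseFit_le (M := M) (φ := φ) (D := D) hβ hn hv
  have hyK : ∀ j, |((1 / 8 : ℝ) • y) j| ≤ K := fun j => by
    have h1 : |y j| ≤ K := by
      refine abs_le_of_sq_le_sq ?_ hK'.le
      have h2 : β * (y j) ^ 2 ≤ 4 := by
        have h3 := covForm_ge φ (β := β) D y
        have h4 : (y j) ^ 2 ≤ y ⬝ᵥ y := by
          rw [← l2norm_sq, ← sq_abs]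
          exact pow_le_pow_left₀ (abs_nonneg _) (abs_apply_le_l2norm y j) 2
        nlinarith [mul_le_mul_of_nonneg_left h4 hβ.le]
      refine le_trans ?_ hK2
      rw [le_div_iff₀ hβ]; linarith
    rw [Pi.smul_apply, smul_eq_mul, abs_mul, abs_of_pos (by norm_num)]
    linarith [abs_nonneg (y j)]
  obtain ⟨u, hu, hue⟩ := exists_mem_gridNet hK hyK
  have hτ : R * d / K ≤ 1 / n := by
    rw [div_le_div_iff₀ hK' (by linarith)]; linarith
  have he : ∀ i, |(D i).feat φ ⬝ᵥ ((1 / 8 : ℝ) • y - u)| ≤ 1 / n := fun i =>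
    (abs_dotProduct_le_of_grid (hR _ _) hue).trans hτ
  have hs : ∀ i, |sampleNoise M D v i| ≤ 2 := fun i => by
    simpa [sampleNoise] using M.abs_noise_le hv (D i).state (D i).action (D i).next
  have h1n : (1 : ℝ) / n ≤ 1 := by rw [div_le_one (by linarith)]; exact hn'
  -- With `e = z/8 - r`, one has `2r² ≤ z²/16 + 4e²`, and the noise times `e` is at most `2/n`. The
  -- scale 1/8 leaves `z²/16`, whose sum is half of the left side and is absorbed.
  have hterm : ∀ i, 1 / 8 * (sampleNoise M D v i * ((D i).feat φ ⬝ᵥ y)) ≤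
      ((D i).feat φ ⬝ᵥ u * sampleNoise M D v i - 2 * ((D i).feat φ ⬝ᵥ u) ^ 2) +
      1 / 16 * ((D i).feat φ ⬝ᵥ y) ^ 2 + 6 * (1 / n) := fun i => by
    have h1 := he i
    rw [dotProduct_sub, dotProduct_smul, smul_eq_mul] at h1
    set z := (D i).feat φ ⬝ᵥ y
    set r := (D i).feat φ ⬝ᵥ u
    have h2 : |(1 / 8 * z - r) * sampleNoise M D v i| ≤ 1 / n * 2 := by
      rw [abs_mul]; exact mul_le_mul h1 (hs i) (abs_nonneg _) (by positivity)
    have h3 := (abs_le.1 h2).2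
    have h4 : (1 / 8 * z - r) ^ 2 ≤ 1 / n := by
      rw [← sq_abs]
      have := abs_nonneg (1 / 8 * z - r)
      nlinarith
    nlinarith [sq_nonneg (1 / 8 * z + (1 / 8 * z - r))]
  have hsum := Finset.sum_le_sum fun i (_ : i ∈ Finset.univ) => hterm i
  simp only [Finset.sum_add_distrib, ← Finset.mul_sum, Finset.sum_const, Finset.card_univ,
    Fintype.card_fin, nsmul_eq_mul] at hsum
  have hqe : ∑ i, sampleNoise M D v i * ((D i).feat φ ⬝ᵥ y) = n * q := by
    rw [hq, covForm_apply, hy, covMatrix_mulVec_noiseFit hβ, dotProduct_comm, smul_dotProduct,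
      sum_dotProduct, smul_eq_mul, mul_inv_cancel_left₀ (by linarith)]
    simp
  have hsq := sum_sq_le_covForm φ D hβ y
  rw [inv_mul_le_iff₀ (by linarith)] at hsq
  have hn1 : 6 * ((n : ℝ) * (1 / n)) = 6 := by field_simp
  have := hℓ u hu
  rw [hqe, hn1] at hsum
  rw [le_div_iff₀ (by linarith)]
  linarith

/-- Error decomposition of the regularized least-squares transition estimate. -/
theorem psiHat_sub_eq (hβ : 0 < β) {ψ : X → Fin d → ℝ} {w : Fin d → ℝ} {R : ℝ}
    (hM : M.IsLinear φ ψ w R) (v : X → ℝ) :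
    psiHat φ β D v - ∑ x, v x • ψ x =
      noiseFit M φ β D v - (covMatrix φ β D)⁻¹ *ᵥ (β • ∑ x, v x • ψ x) := by
  set z := ∑ x, v x • ψ x with hz
  have h1 : (n : ℝ)⁻¹ • ∑ i, v (D i).next • (D i).feat φ =
      (n : ℝ)⁻¹ • ∑ i, sampleNoise M D v i • (D i).feat φ + covMatrix φ β D *ᵥ z - β • z := by
    have h2 : covMatrix φ β D *ᵥ z =
        β • z + (n : ℝ)⁻¹ • ∑ i, ((D i).feat φ ⬝ᵥ z) • (D i).feat φ := by
      rw [covMatrix, add_mulVec, smul_mulVec, one_mulVec, smul_mulVec, sum_mulVec]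
      simp only [vecMulVec_mulVec, op_smul_eq_smul]
    have h3 : ∀ i, v (D i).next • (D i).feat φ =
        sampleNoise M D v i • (D i).feat φ + ((D i).feat φ ⬝ᵥ z) • (D i).feat φ := fun i => by
      rw [← add_smul, Sample.feat, hz, hM.sum_trans, sampleNoise, MDP.noise, sub_add_cancel]
    rw [h2]
    simp only [h3, Finset.sum_add_distrib, smul_add]
    abel
  rw [psiHat, ← mulVec_smul, h1, mulVec_sub, mulVec_add, covMatrix_inv_mulVec φ D hβ, noiseFit]
  abel

theorem covForm_psiHat_sub_le (hβ : 0 < β) {ψ : X → Fin d → ℝ} {w : Fin d → ℝ} {R b : ℝ}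
    (hM : M.IsLinear φ ψ w R) {v : X → ℝ} (hv : ∀ x, |v x| ≤ b) :
    covForm φ β D (psiHat φ β D v - ∑ x, v x • ψ x) (psiHat φ β D v - ∑ x, v x • ψ x) ≤
      2 * covForm φ β D (noiseFit M φ β D v) (noiseFit M φ β D v) + 2 * (β * (b ^ 2 * d)) := by
  rw [psiHat_sub_eq hβ hM]
  refine (form_sub_le (covForm_symm φ β D) (covForm_nonneg φ D hβ) _ _).trans ?_
  have h1 := covForm_ridge_le φ D hβ _ _ (covMatrix_mulVec_inv φ D hβ (β • ∑ x, v x • ψ x))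
  have h2 : l2norm (∑ x, v x • ψ x) ^ 2 ≤ b ^ 2 * d := by
    have := pow_le_pow_left₀ (l2norm_nonneg _) (hM.norm_psi b v hv) 2
    rwa [mul_pow, Real.sq_sqrt (Nat.cast_nonneg d)] at this
  have := mul_le_mul_of_nonneg_left h2 hβ.le
  linarith

variable [Fintype A] [Nonempty A]

/-- The functions and directions for which concentration is required. -/
def NoiseConcentrated (M : MDP X A) (φ : X → A → Fin d → ℝ) (D : Fin n → Sample X A) (K : ℕ)
    (b ℓ : ℝ) : Prop :=
  ∀ θ ∈ gridNet d K, ∀ ϑ ∈ gridNet d K, ∀ u ∈ gridNet d K,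
    ∑ i, ((D i).feat φ ⬝ᵥ u *
        sampleNoise M D (fun x => clip (valueOf φ θ (softmaxPolicy φ ϑ) x / b)) i -
      2 * ((D i).feat φ ⬝ᵥ u) ^ 2) ≤ ℓ

/-- Uniform self-normalized concentration over value functions of softmax policies. -/
theorem NoiseConcentrated.covForm_noiseFit_le (hβ : 0 < β) (hn : 1 ≤ n) {R ℓ b Dθ Dπ : ℝ} {K : ℕ}
    (hR : ∀ x a, l2norm (φ x a) ≤ R) (hR1 : 1 ≤ R) (hd : 1 ≤ d) (hD1 : 1 ≤ Dθ)
    (hK1 : n * (R * d) * (8 * (R * Dθ) + 1) ≤ K) (hK2 : 4 / β ≤ (K : ℝ) ^ 2)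
    (hK3 : Dθ ≤ K) (hK4 : Dπ ≤ K) (hb : 1 ≤ b) (hconc : NoiseConcentrated M φ D K b ℓ)
    {θ : Fin d → ℝ} {π : Policy X A} (hθ : l2norm θ ≤ Dθ) (hπ : π ∈ softmaxClass φ Dπ)
    (hv : ∀ x, |valueOf φ θ π x| ≤ b) :
    covForm φ β D (noiseFit M φ β D (valueOf φ θ π)) (noiseFit M φ β D (valueOf φ θ π)) ≤
      b ^ 2 * ((32 * ℓ + 200) / n) := by
  obtain ⟨ϑ, hϑ, rfl⟩ := hπ
  have hn' : (1 : ℝ) ≤ n := by exact_mod_cast hn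
  have hd' : (1 : ℝ) ≤ d := by exact_mod_cast hd
  have hRd : 1 ≤ R * d := one_le_mul_of_one_le_of_one_le hR1 hd'
  have hRD : 1 ≤ R * Dθ := one_le_mul_of_one_le_of_one_le hR1 hD1
  have hnRd : 1 ≤ n * (R * d) := one_le_mul_of_one_le_of_one_le hn' hRd
  have hK' : (0 : ℝ) < K := by nlinarith
  have hK : 0 < K := by exact_mod_cast hK'
  obtain ⟨θ', hθ', eθ⟩ := exists_mem_gridNet hK
    (fun j => (abs_apply_le_l2norm θ j).trans (hθ.trans hK3))
  obtain ⟨ϑ', hϑ', eϑ⟩ := exists_mem_gridNet hK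
    (fun j => (abs_apply_le_l2norm ϑ j).trans (le_trans hϑ hK4))
  set v := valueOf φ θ (softmaxPolicy φ ϑ) with hvdef
  -- The value function at the grid point may exceed `b`. Clipping restores the bound needed for
  -- concentration, fixes `v / b` and does not increase distances.
  set w : X → ℝ := fun x => clip (valueOf φ θ' (softmaxPolicy φ ϑ') x / b) with hw
  have hdiff : ∀ x, |(b⁻¹ • v - w) x| ≤ 1 / n := fun x => by
    have h1 : (b⁻¹ • v) x = clip (v x / b) := by
      rw [clip_of_abs_le, Pi.smul_apply, smul_eq_mul, div_eq_inv_mul]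
      rw [abs_div, abs_of_pos (by linarith : 0 < b), div_le_one (by linarith)]
      exact hv x
    rw [Pi.sub_apply, h1]
    refine (abs_clip_sub_clip_le _ _).trans ?_
    rw [← sub_div, abs_div, abs_of_pos (by linarith : 0 < b)]
    refine (div_le_self (abs_nonneg _) hb).trans ?_
    refine (abs_valueOf_sub_le φ (κ := R * d / K) (τ := R * d / K) hR hθ (by positivity) ?_
      (fun x a => abs_dotProduct_le_of_grid (hR x a) eϑ)
      (fun x a => abs_dotProduct_le_of_grid (hR x a) eθ) x).trans ?_
    · rw [div_le_div_iff₀ hK' (by norm_num)]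
      nlinarith
    · have : 8 * (R * d / K) * (R * Dθ) + R * d / K = R * d * (8 * (R * Dθ) + 1) / K := by ring
      rw [this, div_le_div_iff₀ hK' (by linarith)]
      linarith
  have h1 : covForm φ β D (noiseFit M φ β D w) (noiseFit M φ β D w) ≤ 16 * (ℓ + 6) / n :=
    covForm_noiseFit_le_of_net hβ hn hK hR (by nlinarith) hK2 (fun x => abs_clip_le _)
      (hconc θ' hθ' ϑ' hϑ')
  have h2 := FOGAS.covForm_noiseFit_le (M := M) (φ := φ) (D := D) hβ hn hdiff
  have e : noiseFit M φ β D v =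
      b • (noiseFit M φ β D w + noiseFit M φ β D (b⁻¹ • v - w)) := by
    rw [noiseFit_sub, noiseFit_smul, add_sub_cancel, smul_inv_smul₀ (by linarith)]
  have h3 := form_add_le (covForm_symm φ β D) (covForm_nonneg φ D hβ) (noiseFit M φ β D w)
    (noiseFit M φ β D (b⁻¹ • v - w))
  have h4 : 4 * (1 / (n : ℝ)) ^ 2 ≤ 4 / n := by
    rw [div_pow, one_pow, mul_one_div, div_le_div_iff₀ (by positivity) (by linarith)]
    nlinarith
  rw [e, map_smul, map_smul, LinearMap.smul_apply, smul_eq_mul, smul_eq_mul, ← mul_assoc, ← sq]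
  refine mul_le_mul_of_nonneg_left ?_ (sq_nonneg b)
  have h5 : (32 * ℓ + 200) / n = 2 * (16 * (ℓ + 6) / n) + 2 * (4 / n) := by ring
  linarith

end Noise

/-! ### Regret decomposition along a run. -/

section Regret

variable {X A : Type*} {d n T : ℕ}
  {φ : X → A → Fin d → ℝ} {β : ℝ} {D : Fin n → Sample X A}

theorem dotProduct_psiHat (hβ : 0 < β) (lam : Fin d → ℝ) (v : X → ℝ) :
    lam ⬝ᵥ psiHat φ β D v = (n : ℝ)⁻¹ *
      ∑ i, v (D i).next * ((D i).feat φ ⬝ᵥ ((covMatrix φ β D)⁻¹ *ᵥ lam)) := by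
  rw [← covForm_inv_left φ D hβ, covForm_apply, psiHat, mulVec_smul, covMatrix_mulVec_inv φ D hβ,
    dotProduct_smul, dotProduct_sum, smul_eq_mul]
  congr 1
  refine Finset.sum_congr rfl fun i _ => ?_
  rw [dotProduct_smul, smul_eq_mul, dotProduct_comm]

variable [Fintype A]

/-- The estimated occupancy is dual to `psiHat`; hence the linear problem solved by `θ t` minimizes
the empirical Lagrangian over the weights. -/
theorem dotProduct_featOccHat (hβ : 0 < β) (γ : ℝ) (x₀ : X) (lam θ : Fin d → ℝ)
    (π : Policy X A) :
    θ ⬝ᵥ featOccHat φ γ x₀ β D lam π =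
      (1 - γ) * valueOf φ θ π x₀ + γ * (lam ⬝ᵥ psiHat φ β D (valueOf φ θ π)) := by
  rw [dotProduct_psiHat hβ, featOccHat, dotProduct_add, dotProduct_smul, dotProduct_smul,
    dotProduct_sum, dotProduct_sum, smul_eq_mul, smul_eq_mul, ← mul_assoc]
  congr 2
  · exact Finset.sum_congr rfl fun a _ => by rw [dotProduct_smul, smul_eq_mul]
  · refine Finset.sum_congr rfl fun i _ => ?_
    rw [dotProduct_sum, valueOf, Finset.sum_mul]
    refine Finset.sum_congr rfl fun a _ => ?_
    rw [dotProduct_smul, smul_eq_mul]; ring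

/-- The empirical Lagrangian, in its two forms. -/
theorem empirical_lagrangian_eq (hβ : 0 < β) (γ : ℝ) (x₀ : X) (lam θ w : Fin d → ℝ)
    (π : Policy X A) :
    (1 - γ) * valueOf φ θ π x₀ + lam ⬝ᵥ (w + γ • psiHat φ β D (valueOf φ θ π) - θ) =
      θ ⬝ᵥ (featOccHat φ γ x₀ β D lam π - lam) + lam ⬝ᵥ w := by
  rw [dotProduct_sub, dotProduct_sub, dotProduct_featOccHat hβ, dotProduct_add, dotProduct_smul,
    smul_eq_mul, dotProduct_comm θ lam]
  ring

section Comparator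

variable [Fintype X] [DecidableEq X] {M : MDP X A} {ψ : X → Fin d → ℝ} {w : Fin d → ℝ} {R : ℝ}

theorem MDP.featOcc_dotProduct (M : MDP X A) (π : Policy X A) (y : Fin d → ℝ) :
    M.featOcc φ π ⬝ᵥ y = ∑ x, ∑ a, M.occupancy π x a * (φ x a ⬝ᵥ y) := by
  simp only [MDP.featOcc, sum_dotProduct, smul_dotProduct, smul_eq_mul]

/-- The return of a comparator in terms of the Lagrangian at an arbitrary policy. -/
theorem MDP.IsLinear.ret_eq_lagrangian (hM : M.IsLinear φ ψ w R) (πs π : Policy X A)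
    (θ : Fin d → ℝ) :
    M.ret πs = (1 - M.γ) * valueOf φ θ π M.x₀ +
      M.featOcc φ πs ⬝ᵥ (w + M.γ • ∑ x, valueOf φ θ π x • ψ x - θ) +
      ∑ x, M.stateOcc πs x * (valueOf φ θ πs x - valueOf φ θ π x) := by
  have h1 : M.featOcc φ πs ⬝ᵥ w = M.ret πs := by
    simp only [M.featOcc_dotProduct, MDP.ret, hM.reward_eq]
  have h2 : M.featOcc φ πs ⬝ᵥ ∑ x, valueOf φ θ π x • ψ x =
      ∑ x, ∑ a, M.occupancy πs x a * ∑ x', M.p x a x' * valueOf φ θ π x' := by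
    simp only [M.featOcc_dotProduct, hM.sum_trans]
  have h3 : M.featOcc φ πs ⬝ᵥ θ = ∑ x, M.stateOcc πs x * valueOf φ θ πs x := by
    simp only [M.featOcc_dotProduct, M.occupancy_eq, valueOf, Finset.mul_sum, mul_assoc,
      dotProduct_comm θ]
  have h4 := M.sum_stateOcc_mul πs (valueOf φ θ π)
  simp only [mul_sub, Finset.sum_sub_distrib]
  rw [dotProduct_sub, dotProduct_add, dotProduct_smul, smul_eq_mul, h1, h2, h3, h4]
  ring

end Comparator

/-- The estimate `psiHat` is a ridge fit to responses of size at most `R * Dθ`, so its Λ-norm is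
bounded without any factor `1 / β`. -/
theorem covForm_gradient_le {w : Fin d → ℝ} {γ Dθ : ℝ} (hβ : 0 < β) (hn : 1 ≤ n) {R : ℝ} (hβR : β ≤ R ^ 2)
    (hR : ∀ x a, l2norm (φ x a) ≤ R) (hw : l2norm w ≤ Dθ) (hγ0 : 0 ≤ γ) (hγ1 : γ ≤ 1)
    {ϑ : Fin d → ℝ} (hϑ : l2norm ϑ ≤ Dθ) (p : Policy X A) :
    covForm φ β D (w + γ • psiHat φ β D (valueOf φ ϑ p) - ϑ)
      (w + γ • psiHat φ β D (valueOf φ ϑ p) - ϑ) ≤ 16 * (R * Dθ) ^ 2 := by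
  have hn' : (0 : ℝ) < n := by exact_mod_cast hn
  have hs := covForm_symm φ β D
  have hp := covForm_nonneg φ D hβ
  have h1 := form_sub_le hs hp (w + γ • psiHat φ β D (valueOf φ ϑ p)) ϑ
  have h2 := form_add_le hs hp w (γ • psiHat φ β D (valueOf φ ϑ p))
  rw [map_smul, map_smul, LinearMap.smul_apply, smul_eq_mul, smul_eq_mul] at h2
  have hball : ∀ z, l2norm z ≤ Dθ → covForm φ β D z z ≤ 2 * (R * Dθ) ^ 2 := fun z hz => by
    refine (covForm_le_of_feat_le φ D hn hR z).trans ?_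
    have := pow_le_pow_left₀ (l2norm_nonneg z) hz 2
    rw [mul_pow, ← mul_assoc]
    exact mul_le_mul (by linarith) this (sq_nonneg _) (by positivity)
  have h3 : covForm φ β D (psiHat φ β D (valueOf φ ϑ p)) (psiHat φ β D (valueOf φ ϑ p)) ≤
      (R * Dθ) ^ 2 := by
    refine (covForm_leastSquares_le φ D hβ (fun i => valueOf φ ϑ p (D i).next) _ ?_).trans ?_
    · rw [psiHat, mulVec_smul, covMatrix_mulVec_inv φ D hβ]
    · have : ∑ i, valueOf φ ϑ p (D i).next ^ 2 ≤ ∑ _i : Fin n, (R * Dθ) ^ 2 :=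
        Finset.sum_le_sum fun i _ => by
          rw [← sq_abs]
          exact pow_le_pow_left₀ (abs_nonneg _) (abs_valueOf_le hR hϑ p _) 2
      simp only [Finset.sum_const, Finset.card_univ, Fintype.card_fin, nsmul_eq_mul] at this
      rwa [inv_mul_le_iff₀ hn']
  have h4 := hp (psiHat φ β D (valueOf φ ϑ p))
  have h5 : γ * (γ * covForm φ β D (psiHat φ β D (valueOf φ ϑ p))
      (psiHat φ β D (valueOf φ ϑ p))) ≤ (R * Dθ) ^ 2 := by
    rw [← mul_assoc]
    exact (mul_le_of_le_one_left h4 (mul_le_one₀ hγ1 hγ0 hγ1)).trans h3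
  linarith [hball w hw, hball ϑ hϑ]

variable [Nonempty A] {w : Fin d → ℝ} {γ : ℝ} {x₀ : X} {α ϱ η Dθ Dπ : ℝ} {π₁ : Policy X A}
  {lam : ℕ → Fin d → ℝ} {π : ℕ → Policy X A} {θ : ℕ → Fin d → ℝ}

/-- The parameter is `α` times a sum of fewer than `T` vectors of the `Dθ`-ball. Bounds uniform over
the class therefore apply to the data-dependent iterates. -/
theorem IsRun.policy_mem (hrun : IsRun φ w γ x₀ D T α ϱ η β Dθ Dπ π₁ lam π θ) (hα : 0 ≤ α)
    (hDθ : 0 ≤ Dθ) (hDπ : Dπ = α * T * Dθ) {t : ℕ} (ht : t ∈ Finset.Icc 1 T) :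
    π t ∈ softmaxClass φ Dπ := by
  rw [Finset.mem_Icc] at ht
  obtain ⟨s, rfl⟩ : ∃ s, t = s + 1 := ⟨t - 1, by omega⟩
  rcases Nat.eq_zero_or_pos s with rfl | hs
  · rw [zero_add, hrun.pi_init]; exact hrun.pi_init_mem
  · refine ⟨_, ?_, hrun.pi_step s (by simp; omega)⟩
    change l2norm _ ≤ Dπ
    rw [l2norm_smul, abs_of_nonneg hα, hDπ, mul_assoc]
    refine mul_le_mul_of_nonneg_left ?_ hα
    refine (l2norm_sum_le _ _).trans ?_
    have h1 : ∑ k ∈ Finset.Icc 1 s, l2norm (θ k) ≤ ∑ _k ∈ Finset.Icc 1 s, Dθ :=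
      Finset.sum_le_sum fun k hk => hrun.theta_mem k (by
        rw [Finset.mem_Icc] at hk ⊢; omega)
    rw [Finset.sum_const, Nat.card_Icc, nsmul_eq_mul, Nat.add_sub_cancel] at h1
    refine h1.trans (mul_le_mul_of_nonneg_right ?_ hDθ)
    exact_mod_cast (by omega : s ≤ T)

theorem IsRun.policy_regret (hrun : IsRun φ w γ x₀ D T α ϱ η β Dθ Dπ (uniformPolicy X A) lam π θ)
    (hα : 0 < α) {R : ℝ} (hR : ∀ x a, l2norm (φ x a) ≤ R) (πs : Policy X A) (x : X) :
    ∑ t ∈ Finset.Icc 1 T, (valueOf φ (θ t) πs x - valueOf φ (θ t) (π t) x) ≤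
      Real.log (Fintype.card A) / α + T * (2 * α * (R * Dθ) ^ 2) := by
  refine exponentialWeights_regret hα T (fun t a => θ t ⬝ᵥ φ x a) ?_ (fun t => (π t).prob x) ?_
    (πs.prob x) (πs.nonneg x) (πs.sum_one x)
  · intro t ht a
    rw [mul_comm R]
    have := hrun.theta_mem t ht
    exact (abs_dotProduct_le _ _).trans (mul_le_mul this (hR x a) (l2norm_nonneg _)
      ((l2norm_nonneg _).trans this))
  · intro t ht a
    have e : ∀ c, φ x c ⬝ᵥ (α • ∑ k ∈ Finset.Icc 1 t, θ k) =
        α * ∑ k ∈ Finset.Icc 1 t, θ k ⬝ᵥ φ x c := fun c => by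
      rw [dotProduct_smul, dotProduct_sum, smul_eq_mul]
      simp only [dotProduct_comm]
    have hπ : π (t + 1) = softmaxPolicy φ (α • ∑ k ∈ Finset.Icc 1 t, θ k) := by
      rcases Nat.eq_zero_or_pos t with rfl | h0
      · rw [zero_add, hrun.pi_init, uniformPolicy_eq_softmaxPolicy φ]; simp
      · exact hrun.pi_step t (by simp; omega)
    simp only [hπ, softmaxPolicy, e]

/-- In the coordinates Λ⁻¹λ the preconditioner disappears, and the update has the form required by
`ascent_regret`. -/
theorem IsRun.ascent_eq (hrun : IsRun φ w γ x₀ D T α ϱ η β Dθ Dπ π₁ lam π θ) (hβ : 0 < β)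
    (hϱ : 0 ≤ ϱ) (hη : 0 < η) {t : ℕ} (ht : t ∈ Finset.Icc 1 T) :
    (1 + ϱ * η) • ((covMatrix φ β D)⁻¹ *ᵥ lam (t + 1)) = (covMatrix φ β D)⁻¹ *ᵥ lam t +
      η • (w + γ • psiHat φ β D (valueOf φ (θ t) (π t)) - θ t) := by
  have h : (1 + ϱ * η) ≠ 0 := by positivity
  rw [hrun.lam_step t ht, mulVec_smul, mulVec_add, mulVec_smul, covMatrix_inv_mulVec φ D hβ,
    one_div, smul_inv_smul₀ h]

/-- Regret of a run on a data set on which the transition estimate is accurate: `e₁` bounds the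
error for all value functions of the class and `e₂` for those with values of order
`1 / (1 - γ)`. -/
theorem IsRun.sum_ret_sub_le [Fintype X] [DecidableEq X] {M : MDP X A} {ψ : X → Fin d → ℝ}
    {R e₁ e₂ c : ℝ} (hM : M.IsLinear φ ψ w R)
    (hrun : IsRun φ w M.γ M.x₀ D T α ϱ η β Dθ Dπ (uniformPolicy X A) lam π θ)
    (hn : 1 ≤ n) (hDθ : Dθ = √d / (1 - M.γ)) (hDπ : Dπ = α * T * Dθ) (hβ : 0 < β)
    (hβR : β ≤ R ^ 2) (hα : 0 < α) (hϱ : 0 < ϱ) (hη : 0 < η) (hc : 0 < c)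
    (he₁ : ∀ ϑ, l2norm ϑ ≤ Dθ → ∀ p ∈ softmaxClass φ Dπ,
      covForm φ β D (psiHat φ β D (valueOf φ ϑ p) - ∑ x, valueOf φ ϑ p x • ψ x)
        (psiHat φ β D (valueOf φ ϑ p) - ∑ x, valueOf φ ϑ p x • ψ x) ≤ e₁)
    (he₂ : ∀ ϑ, l2norm ϑ ≤ Dθ → ∀ p ∈ softmaxClass φ Dπ,
      (∀ x, |valueOf φ ϑ p x| ≤ 1 / (1 - M.γ)) →
      covForm φ β D (psiHat φ β D (valueOf φ ϑ p) - ∑ x, valueOf φ ϑ p x • ψ x)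
        (psiHat φ β D (valueOf φ ϑ p) - ∑ x, valueOf φ ϑ p x • ψ x) ≤ e₂)
    (πs : Policy X A) :
    ∑ t ∈ Finset.Icc 1 T, (M.ret πs - M.ret (π t)) ≤
      Real.log (Fintype.card A) / α + T * (2 * α * (R * Dθ) ^ 2) +
      invNormSq (covMatrix φ β D) (M.featOcc φ πs) / (2 * η) + η / 2 * (T * (16 * (R * Dθ) ^ 2)) +
      T * (ϱ / 2 * invNormSq (covMatrix φ β D) (M.featOcc φ πs)) +
      T * (M.γ * (c * invNormSq (covMatrix φ β D) (M.featOcc φ πs) + e₁ / c) / 2) +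
      T * (M.γ ^ 2 * e₂ / (2 * ϱ)) := by
  have hs := covForm_symm φ β D
  have hp := covForm_nonneg φ D hβ
  have hγ := sub_pos.2 M.γ_lt_one
  have hDθ0 : 0 ≤ Dθ := by rw [hDθ]; positivity
  set ls := M.featOcc φ πs with hls
  set ys := (covMatrix φ β D)⁻¹ *ᵥ ls with hys
  set y : ℕ → Fin d → ℝ := fun t => (covMatrix φ β D)⁻¹ *ᵥ lam t with hy
  set v : ℕ → X → ℝ := fun t => valueOf φ (θ t) (π t) with hv
  set g : ℕ → Fin d → ℝ := fun t => w + M.γ • psiHat φ β D (v t) - θ t with hg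
  rw [invNormSq_eq_covForm φ D hβ]
  have hstep : ∀ t ∈ Finset.Icc 1 T, M.ret πs - M.ret (π t) ≤
      ∑ x, M.stateOcc πs x * (valueOf φ (θ t) πs x - valueOf φ (θ t) (π t) x) +
      covForm φ β D (ys - y t) (g t) +
      M.γ * (c * covForm φ β D ys ys + e₁ / c) / 2 +
      (ϱ / 2 * covForm φ β D (y t) (y t) + M.γ ^ 2 * e₂ / (2 * ϱ)) := by
    intro t ht
    have hmem := hrun.policy_mem hα.le hDθ0 hDπ ht
    have hθt : l2norm (θ t) ≤ Dθ := hrun.theta_mem t ht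
    obtain ⟨ϑ, hϑD, hϑ, hϑv, hϑr⟩ := hM.exists_value_weights (π t)
    rw [← hDθ] at hϑD
    have r1 := hM.ret_eq_lagrangian πs (π t) (θ t)
    set Δ := psiHat φ β D (v t) - ∑ x, v t x • ψ x with hΔ
    set u := valueOf φ ϑ (π t) with hu
    set Δ' := psiHat φ β D u - ∑ x, u x • ψ x with hΔ'
    have r2 : w + M.γ • ∑ x, valueOf φ (θ t) (π t) x • ψ x - θ t = g t - M.γ • Δ := by
      simp only [hg, hΔ, hv, smul_sub]; abel
    have r3 : ls ⬝ᵥ (g t - M.γ • Δ) = covForm φ β D ys (g t) - M.γ * covForm φ β D ys Δ := by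
      rw [← covForm_inv_left φ D hβ, map_sub, map_smul, smul_eq_mul]
    have r4 : w + M.γ • psiHat φ β D u - ϑ = M.γ • Δ' := by
      nth_rw 1 [hϑ]
      simp only [hΔ', smul_sub]; abel
    have r5 : lam t ⬝ᵥ (M.γ • Δ') = M.γ * covForm φ β D (y t) Δ' := by
      rw [← covForm_inv_left φ D hβ, map_smul, smul_eq_mul]
    have r6 : lam t ⬝ᵥ g t = covForm φ β D (y t) (g t) := by
      rw [← covForm_inv_left φ D hβ]
    have hmin : θ t ⬝ᵥ (featOccHat φ M.γ M.x₀ β D (lam t) (π t) - lam t) ≤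
        ϑ ⬝ᵥ (featOccHat φ M.γ M.x₀ β D (lam t) (π t) - lam t) := hrun.theta_min t ht hϑD
    have l1 := empirical_lagrangian_eq (φ := φ) (D := D) hβ M.γ M.x₀ (lam t) (θ t) w (π t)
    have l2 := empirical_lagrangian_eq (φ := φ) (D := D) hβ M.γ M.x₀ (lam t) ϑ w (π t)
    rw [← hu, r4, r5, ← hϑr] at l2
    change _ + lam t ⬝ᵥ g t = _ at l1
    rw [r6] at l1
    rw [r2, r3] at r1
    -- The comparator's pairing keeps a free scale `c`. The scale `ϱ / γ` in the other one makes its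
    -- cost, after multiplication by `γ`, match the negative term of `ascent_regret`.
    have y1 := two_mul_form_le hs hp hc (-ys) Δ
    have y2 := two_mul_form_le hs hp (c := ϱ / M.γ) (div_pos hϱ M.γ_pos) (y t) Δ'
    have b1 : covForm φ β D Δ Δ ≤ e₁ := he₁ _ hθt _ hmem
    have b2 : covForm φ β D Δ' Δ' ≤ e₂ := he₂ _ hϑD _ hmem hϑv
    simp only [map_neg, LinearMap.neg_apply, neg_neg] at y1
    have b1' := div_le_div_of_nonneg_right b1 hc.le
    have b2' := div_le_div_of_nonneg_right b2 (div_pos hϱ M.γ_pos).le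
    have z1 := mul_le_mul_of_nonneg_left (y1.trans (add_le_add_right b1' _)) M.γ_pos.le
    have z2 := mul_le_mul_of_nonneg_left (y2.trans (add_le_add_right b2' _)) M.γ_pos.le
    have z3 : M.γ * (ϱ / M.γ * covForm φ β D (y t) (y t) + e₂ / (ϱ / M.γ)) =
        2 * (ϱ / 2 * covForm φ β D (y t) (y t) + M.γ ^ 2 * e₂ / (2 * ϱ)) := by
      have := M.γ_pos.ne'
      field_simp
    rw [z3] at z2
    rw [LinearMap.map_sub₂]
    linarith
  have hsum := Finset.sum_le_sum hstep
  simp only [Finset.sum_add_distrib, Finset.sum_const, Nat.card_Icc, Nat.add_sub_cancel,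
    nsmul_eq_mul, ← Finset.mul_sum] at hsum
  have hpol : ∑ t ∈ Finset.Icc 1 T, ∑ x, M.stateOcc πs x *
      (valueOf φ (θ t) πs x - valueOf φ (θ t) (π t) x) ≤
      Real.log (Fintype.card A) / α + T * (2 * α * (R * Dθ) ^ 2) := by
    rw [Finset.sum_comm]
    simp only [← Finset.mul_sum]
    calc _ ≤ ∑ x, M.stateOcc πs x *
          (Real.log (Fintype.card A) / α + T * (2 * α * (R * Dθ) ^ 2)) :=
          Finset.sum_le_sum fun x _ => mul_le_mul_of_nonneg_left
            (hrun.policy_regret hα hM.norm_feat πs x) (M.stateOcc_nonneg πs x)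
      _ = _ := by rw [← Finset.sum_mul, M.sum_stateOcc, one_mul]
  have hasc := ascent_regret hs hp hϱ.le hη T ys y g (by simp [hy, hrun.lam_init])
    (fun t ht => hrun.ascent_eq hβ hϱ.le hη ht)
  have hwD : l2norm w ≤ Dθ := by
    refine hM.norm_w.trans ?_
    rw [hDθ, le_div_iff₀ hγ]
    nlinarith [Real.sqrt_nonneg (d : ℝ), M.γ_pos]
  have hgr : ∑ t ∈ Finset.Icc 1 T, covForm φ β D (g t) (g t) ≤ T * (16 * (R * Dθ) ^ 2) := by
    refine (Finset.sum_le_sum fun t ht => covForm_gradient_le hβ hn hβR hM.norm_feat hwD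
      M.γ_pos.le M.γ_lt_one.le (hrun.theta_mem t ht) (π t)).trans ?_
    simp
  have hgr' := mul_le_mul_of_nonneg_left hgr (half_pos hη).le
  linarith

end Regret

/-! ### Arithmetic of the tuned parameters. -/

section Tuning

theorem le_of_sq_le_sq' {a b : ℝ} (h : a ^ 2 ≤ b ^ 2) (hb : 0 ≤ b) : a ≤ b :=
  (abs_le_of_sq_le_sq' h hb).2

variable {d n T R g l L α η D E : ℝ}

/-- The tuned learning rates make the optimization errors of the order of the statistical rate
`E = √(d² L / n) / g`. -/
theorem tuned_optimization_errors (hd : 1 ≤ d) (hn : 0 < n) (hT : 0 < T) (hR : 1 ≤ R)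
    (hg : 0 < g) (hl : 0 < l) (hL : 0 < L) (h : 2 * R ^ 2 * n * l ≤ T * L)
    (h' : R ^ 2 * n ≤ T * L) (hα : α = √(2 * g ^ 2 * l / (R ^ 2 * d * T)))
    (hη : η = √(g ^ 2 / (27 * R ^ 2 * d ^ 2 * T))) (hD : D = √d / g)
    (hE : E = √(d ^ 2 * L / n) / g) :
    l / α ≤ T * (E / 2) ∧ 2 * α * (R * D) ^ 2 ≤ 2 * E ∧ 1 / (2 * η) ≤ T * (3 * E) ∧
      η / 2 * (16 * (R * D) ^ 2) ≤ 2 * E := by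
  have hR0 : 0 < R := by linarith
  have hd0 : 0 < d := by linarith
  have hα0 : 0 < α := by rw [hα]; positivity
  have hη0 : 0 < η := by rw [hη]; positivity
  have hE0 : 0 < E := by rw [hE]; positivity
  have hα2 : α ^ 2 = 2 * g ^ 2 * l / (R ^ 2 * d * T) := by rw [hα, Real.sq_sqrt (by positivity)]
  have hη2 : η ^ 2 = g ^ 2 / (27 * R ^ 2 * d ^ 2 * T) := by rw [hη, Real.sq_sqrt (by positivity)]
  have hD2 : D ^ 2 = d / g ^ 2 := by rw [hD, div_pow, Real.sq_sqrt (by positivity)]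
  have hE2 : E ^ 2 = d ^ 2 * L / (n * g ^ 2) := by
    rw [hE, div_pow, Real.sq_sqrt (by positivity), div_div]
  have hTL : 0 ≤ T * L := by positivity
  have hdd : 1 ≤ d ^ 2 := one_le_pow₀ hd
  refine ⟨?_, ?_, ?_, ?_⟩
  · rw [div_le_iff₀ hα0]
    refine le_of_sq_le_sq' ?_ (by positivity)
    have e : (T * (E / 2) * α) ^ 2 = l * (d * (T * L)) / (2 * R ^ 2 * n) := by
      rw [mul_pow, mul_pow, div_pow, hα2, hE2]; field_simp
    rw [e, le_div_iff₀ (by positivity)]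
    nlinarith [mul_le_mul_of_nonneg_left h hl.le, mul_nonneg hl.le hTL,
      mul_nonneg (mul_nonneg hl.le hTL) (sub_nonneg.2 hd)]
  · refine le_of_sq_le_sq' ?_ (by positivity)
    have e : (2 * α * (R * D) ^ 2) ^ 2 = 4 * (2 * R ^ 2 * l) * d / (T * g ^ 2) := by
      rw [mul_pow, mul_pow, hα2, mul_pow, hD2]; field_simp; ring
    have e' : (2 * E) ^ 2 = 4 * d ^ 2 * L / (n * g ^ 2) := by
      rw [mul_pow, hE2]; field_simp; ring
    rw [e, e', div_le_div_iff₀ (by positivity) (by positivity)]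
    have h1 : 2 * R ^ 2 * n * l * d ≤ T * L * d ^ 2 := by
      nlinarith [mul_le_mul_of_nonneg_right h hd0.le,
        mul_nonneg (mul_nonneg hTL hd0.le) (sub_nonneg.2 hd)]
    nlinarith [mul_le_mul_of_nonneg_left h1 (sq_nonneg g)]
  · rw [div_le_iff₀ (by positivity)]
    refine le_of_sq_le_sq' ?_ (by positivity)
    have e : (T * (3 * E) * (2 * η)) ^ 2 = 36 * (T * L) / (27 * (R ^ 2 * n)) := by
      rw [mul_pow, mul_pow, mul_pow, mul_pow, hη2, hE2]; field_simp; ring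
    rw [e, le_div_iff₀ (by positivity)]
    linarith
  · refine le_of_sq_le_sq' ?_ (by positivity)
    have e : (η / 2 * (16 * (R * D) ^ 2)) ^ 2 = 64 * R ^ 2 / (27 * T * g ^ 2) := by
      rw [mul_pow, div_pow, mul_pow, hη2, mul_pow, hD2]; field_simp; ring
    have e' : (2 * E) ^ 2 = 4 * d ^ 2 * L / (n * g ^ 2) := by
      rw [mul_pow, hE2]; field_simp; ring
    rw [e, e', div_le_div_iff₀ (by positivity) (by positivity)]
    have h1 : R ^ 2 * n ≤ T * L * d ^ 2 := by nlinarith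
    nlinarith [mul_le_mul_of_nonneg_left h1 (sq_nonneg g), mul_pos hR0 hR0,
      mul_nonneg (sq_nonneg g) (mul_nonneg (sq_nonneg R) hn.le)]

/-- A resolution `K`, polynomial in `Z`, that is fine enough for the net argument. -/
theorem net_resolution {Z β Dπ : ℝ} (hd : 1 ≤ d) (hR : 1 ≤ R) (hg : 0 < g) (hg1 : g ≤ 1)
    (hl : 0 < l) (_hn : 0 < n) (hT : 0 < T) (hZ : 2 ≤ Z) (hnZ : 2 * n ≤ Z) (hTZ : 2 * T ≤ Z)
    (hlZ : l ≤ Z) (hG : (R * d / g) ^ 2 ≤ Z) (hα : α = √(2 * g ^ 2 * l / (R ^ 2 * d * T)))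
    (hD : D = √d / g) (hβ : β = R ^ 2 / (d * T)) (hDπ : Dπ = α * T * D) :
    1 ≤ D ∧ n * (R * d) * (8 * (R * D) + 1) ≤ (⌈Z ^ 5⌉₊ : ℝ) ∧ 4 / β ≤ (⌈Z ^ 5⌉₊ : ℝ) ^ 2 ∧
      D ≤ (⌈Z ^ 5⌉₊ : ℝ) ∧ Dπ ≤ (⌈Z ^ 5⌉₊ : ℝ) ∧
      2 * (⌈Z ^ 5⌉₊ : ℝ) ^ 2 + 1 ≤ Z ^ 14 := by
  have hR0 : 0 < R := by linarith
  have hd0 : 0 < d := by linarith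
  have hZ0 : 0 < Z := by linarith
  set G := R * d / g with hGdef
  have hK := Nat.le_ceil (Z ^ 5)
  have hK' := (Nat.ceil_lt_add_one (by positivity : 0 ≤ Z ^ 5)).le
  set K : ℝ := (⌈Z ^ 5⌉₊ : ℝ)
  have hZ3 : (2 : ℝ) ^ 3 ≤ Z ^ 3 := pow_le_pow_left₀ (by norm_num) hZ 3
  -- The most demanding requirement on the resolution below is `9/2 * Z ^ 2`.
  have hZ5 : 8 * Z ^ 2 ≤ Z ^ 5 := by nlinarith [mul_le_mul_of_nonneg_right hZ3 (sq_nonneg Z)]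
  have hZZ : Z ≤ Z ^ 2 := by nlinarith
  have hRd : R * d ≤ G := by
    rw [hGdef, le_div_iff₀ hg]; nlinarith [mul_pos hR0 hd0]
  have hG1 : 1 ≤ G := (one_le_mul_of_one_le_of_one_le hR hd).trans hRd
  have hGZ : G ≤ Z := by nlinarith
  have hdG : d ≤ G := (by nlinarith : d ≤ R * d).trans hRd
  have hsd : √d ≤ d := by
    rw [Real.sqrt_le_left hd0.le]; nlinarith
  have hsd1 : 1 ≤ √d := Real.one_le_sqrt.2 hd
  have hD1 : 1 ≤ D := by rw [hD, le_div_iff₀ hg]; linarith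
  have hRD : R * D ≤ G := by
    rw [hD, hGdef, ← mul_div_assoc]
    exact div_le_div_of_nonneg_right (mul_le_mul_of_nonneg_left hsd hR0.le) hg.le
  have hDG : D ≤ G := le_trans (by nlinarith) hRD
  refine ⟨hD1, ?_, ?_, ?_, ?_, ?_⟩
  · refine le_trans ?_ hK
    have h1 : R * d * (8 * (R * D) + 1) ≤ G * (9 * G) :=
      mul_le_mul hRd (by linarith) (by positivity) (by linarith)
    have h2 : n * (R * d * (8 * (R * D) + 1)) ≤ Z / 2 * (9 * Z) :=
      mul_le_mul (by linarith) (by linarith) (by positivity) (by linarith)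
    rw [mul_assoc]
    linarith [sq_nonneg Z]
  · have hK1 : 1 ≤ K := by linarith
    have h1 : 4 / β ≤ 4 * (d * T) := by
      rw [hβ, div_div_eq_mul_div]
      exact div_le_self (by positivity) (one_le_pow₀ hR)
    have h2 : d * (2 * T) ≤ Z * Z := mul_le_mul (by linarith) hTZ (by linarith) hZ0.le
    calc 4 / β ≤ K := by linarith [sq_nonneg Z]
      _ ≤ K ^ 2 := by nlinarith only [hK1]
  · linarith
  · refine le_trans (le_of_sq_le_sq' ?_ hZ0.le) (by linarith : Z ≤ K)
    have e : Dπ ^ 2 = 2 * T * l / R ^ 2 := by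
      rw [hDπ, mul_pow, mul_pow, hα, Real.sq_sqrt (by positivity), hD, div_pow,
        Real.sq_sqrt hd0.le]
      field_simp
    rw [e, div_le_iff₀ (by positivity)]
    have h1 : 2 * T * l ≤ Z * Z := mul_le_mul hTZ hlZ hl.le hZ0.le
    exact h1.trans (le_trans (le_of_eq (sq Z).symm)
      (le_mul_of_one_le_right (sq_nonneg Z) (one_le_pow₀ hR)))
  · have h1 : K ≤ Z ^ 6 := by
      have : 2 * Z ^ 5 ≤ Z * Z ^ 5 := mul_le_mul_of_nonneg_right hZ (by positivity)
      have e : Z ^ 6 = Z * Z ^ 5 := by ring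
      linarith
    have h2 : K ^ 2 ≤ Z ^ 12 := by
      have := pow_le_pow_left₀ (by linarith) h1 2
      rwa [← pow_mul] at this
    have h3 : 3 * Z ^ 12 ≤ Z ^ 2 * Z ^ 12 :=
      mul_le_mul_of_nonneg_right (by nlinarith only [hZ]) (by positivity)
    have h4 : 1 ≤ K ^ 2 := one_le_pow₀ (by linarith)
    have e : Z ^ 14 = Z ^ 2 * Z ^ 12 := by ring
    linarith

/-- Collecting the terms of the regret bound after tuning. -/
theorem tuned_regret_le {γ ϱ Q s : ℝ} (hγ0 : 0 < γ) (hγ1 : γ ≤ 1) (hR : 1 ≤ R) (hE : 0 < E)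
    (hQ : 0 ≤ Q) (hT : 0 ≤ T) (hϱ : ϱ = γ * (√320 * E)) (t1 : l / α ≤ T * (E / 2))
    (t2 : 2 * α * s ≤ 2 * E) (t3 : 1 / (2 * η) ≤ T * (3 * E)) (t4 : η / 2 * (16 * s) ≤ 2 * E) :
    l / α + T * (2 * α * s) + Q / (2 * η) + η / 2 * (T * (16 * s)) + T * (ϱ / 2 * Q) +
      T * (γ * (R * E * Q + 3554 * (R ^ 2 * E ^ 2) / (R * E)) / 2) +
      T * (γ ^ 2 * (3554 * E ^ 2) / (2 * ϱ)) ≤ T * (2000 * R * E * (Q + 1)) := by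
  have s1 : (17 : ℝ) ≤ √320 := Real.le_sqrt_of_sq_le (by norm_num)
  have s2 : √320 ≤ (18 : ℝ) := Real.sqrt_le_iff.2 (by norm_num)
  have hRE : E ≤ R * E := le_mul_of_one_le_left hE.le hR
  have hRE0 : 0 < R * E := hE.trans_le hRE
  have hREQ : 0 ≤ R * E * Q := mul_nonneg hRE0.le hQ
  have u3 : Q / (2 * η) ≤ T * (3 * E * Q) := by
    have := mul_le_mul_of_nonneg_right t3 hQ
    rw [one_div_mul_eq_div] at this
    linarith
  have u5 : ϱ / 2 * Q ≤ 9 * E * Q := by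
    refine mul_le_mul_of_nonneg_right ?_ hQ
    have : γ * (√320 * E) ≤ 1 * (18 * E) :=
      mul_le_mul hγ1 (mul_le_mul_of_nonneg_right s2 hE.le) (by positivity) zero_le_one
    rw [hϱ]; linarith
  have u6 : γ * (R * E * Q + 3554 * (R ^ 2 * E ^ 2) / (R * E)) / 2 ≤
      R * E * Q + 1777 * (R * E) := by
    have e : 3554 * (R ^ 2 * E ^ 2) / (R * E) = 3554 * (R * E) := by
      rw [← mul_pow, sq, ← mul_assoc, mul_div_cancel_right₀ _ hRE0.ne']
    rw [e]
    have := mul_le_of_le_one_left (by linarith : 0 ≤ R * E * Q + 3554 * (R * E)) hγ1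
    linarith
  have u7 : γ ^ 2 * (3554 * E ^ 2) / (2 * ϱ) ≤ 105 * E := by
    have e : γ ^ 2 * (3554 * E ^ 2) / (2 * ϱ) = γ * (1777 * E / √320) := by
      rw [hϱ]; field_simp; norm_num
    have h1 : 1777 * E / √320 ≤ 105 * E := by
      rw [div_le_iff₀ (by linarith)]
      have := mul_le_mul_of_nonneg_left s1 hE.le
      linarith
    rw [e]
    exact (mul_le_of_le_one_left (by positivity) hγ1).trans h1
  have hEQ : E * Q ≤ R * E * Q := mul_le_mul_of_nonneg_right hRE hQ
  have v2 := mul_le_mul_of_nonneg_left t2 hT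
  have v4 := mul_le_mul_of_nonneg_left t4 hT
  have v5 := mul_le_mul_of_nonneg_left u5 hT
  have v6 := mul_le_mul_of_nonneg_left u6 hT
  have v7 := mul_le_mul_of_nonneg_left u7 hT
  -- Since `E ≤ R * E`, the coefficients add up to 1886.5 without `Q` and to 13 with it.
  have fin : E / 2 + 2 * E + 3 * E * Q + 2 * E + 9 * E * Q + (R * E * Q + 1777 * (R * E)) +
      105 * E ≤ 2000 * R * E * (Q + 1) := by linarith
  have := mul_le_mul_of_nonneg_left fin hT
  linarith

end Tuning

/-! ### The high-probability event and the final bound. -/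

section Main

/-- The number of events in the union bound contributes only logarithmically. -/
theorem log_card_le {d N K : ℕ} {Z δ : ℝ} (hd : 1 ≤ d) (hδ : 0 < δ) (hZ : 2 ≤ Z)
    (hZδ : 2 / δ ≤ Z) (hN0 : 0 < N) (hN : N ≤ 2 * ((2 * K ^ 2 + 1) ^ d) ^ 3)
    (hK : 2 * (K : ℝ) ^ 2 + 1 ≤ Z ^ 14) :
    Real.log (N / δ) ≤ 43 * (d * Real.log Z) := by
  have hN0' : (0 : ℝ) < N := by exact_mod_cast hN0
  have hd' : (1 : ℝ) ≤ d := by exact_mod_cast hd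
  have hN' : (N : ℝ) ≤ 2 * ((2 * (K : ℝ) ^ 2 + 1) ^ d) ^ 3 := by exact_mod_cast hN
  -- Three grids contribute `14 * d` each; the two scales and `δ` cost one more power of `Z`.
  have h1 : (N : ℝ) / δ ≤ Z ^ (14 * d * 3 + 1) := by
    calc (N : ℝ) / δ ≤ 2 * ((Z ^ 14) ^ d) ^ 3 / δ := by
          refine div_le_div_of_nonneg_right (hN'.trans ?_) hδ.le
          gcongr
      _ = (2 / δ) * Z ^ (14 * d * 3) := by rw [← pow_mul, ← pow_mul]; ring
      _ ≤ Z * Z ^ (14 * d * 3) := by gcongr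
      _ = Z ^ (14 * d * 3 + 1) := by ring
  refine (Real.log_le_log (by positivity) h1).trans ?_
  rw [Real.log_pow]
  have hL : 0 ≤ Real.log Z := Real.log_nonneg (by linarith)
  push_cast
  nlinarith

variable {X A : Type*} [Fintype X] [Fintype A] {d n T : ℕ}
  {M : MDP X A} {φ : X → A → Fin d → ℝ} {ψ : X → Fin d → ℝ} {w : Fin d → ℝ} {R : ℝ}

/-- With probability at least `1 - δ`, the noise concentrates at two scales simultaneously. -/
theorem IsOfflineData.one_sub_le_real_noiseConcentrated [Nonempty A] {Ω : Type*}
    [MeasurableSpace Ω] {P : Measure Ω} [IsProbabilityMeasure P] {D : Ω → Fin n → Sample X A}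
    (hD : IsOfflineData M P D) {Z δ b₁ b₂ : ℝ} {K : ℕ} (hd : 1 ≤ d) (hδ : 0 < δ) (hZ : 2 ≤ Z)
    (hZδ : 2 / δ ≤ Z) (hK : 2 * (K : ℝ) ^ 2 + 1 ≤ Z ^ 14) :
    1 - δ ≤ P.real {ω | NoiseConcentrated M φ (D ω) K b₁ (43 * (d * Real.log Z)) ∧
      NoiseConcentrated M φ (D ω) K b₂ (43 * (d * Real.log Z))} := by
  classical
  set N : Finset (ℝ × (Fin d → ℝ) × (Fin d → ℝ) × (Fin d → ℝ)) :=
    {b₁, b₂} ×ˢ gridNet d K ×ˢ gridNet d K ×ˢ gridNet d K with hN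
  have hcard : N.card ≤ 2 * ((2 * K ^ 2 + 1) ^ d) ^ 3 := by
    have h2 := Finset.card_le_two (a := b₁) (b := b₂)
    have h3 := card_gridNet_le d K
    simp only [hN, Finset.card_product]
    calc _ ≤ 2 * ((2 * K ^ 2 + 1) ^ d * ((2 * K ^ 2 + 1) ^ d * (2 * K ^ 2 + 1) ^ d)) := by gcongr
      _ = _ := by ring
  have h := hD.one_sub_le_real N
    (fun j x => clip (valueOf φ j.2.1 (softmaxPolicy φ j.2.2.1) x / j.1))
    (fun j x => abs_clip_le _) (fun j x a => φ x a ⬝ᵥ j.2.2.2) hδ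
  refine h.trans (measureReal_mono ?_)
  intro ω hω
  have key : ∀ b ∈ ({b₁, b₂} : Finset ℝ),
      NoiseConcentrated M φ (D ω) K b (43 * (d * Real.log Z)) := by
    intro b hb θ hθ ϑ hϑ u hu
    have hmem : (b, θ, ϑ, u) ∈ N := by
      simp only [hN, Finset.mem_product]; exact ⟨hb, hθ, hϑ, hu⟩
    exact (hω _ hmem).trans
      (log_card_le hd hδ hZ hZδ (Finset.card_pos.2 ⟨_, hmem⟩) hcard hK)
  exact ⟨key _ (by simp), key _ (by simp)⟩

variable [Nonempty A]

/-- The error of the transition estimate on data sets with concentrated noise. -/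
theorem covForm_transition_error_le {D : Fin n → Sample X A} {β Dθ Dπ L b : ℝ} {K : ℕ}
    (hM : M.IsLinear φ ψ w R) (hn : 1 ≤ n) (hT : 1 ≤ T) (hL : 1 / 2 ≤ L)
    (hT2 : R ^ 2 * n ≤ T * L) (hβ : β = R ^ 2 / (d * T)) (hD1 : 1 ≤ Dθ)
    (hK1 : n * (R * d) * (8 * (R * Dθ) + 1) ≤ K) (hK2 : 4 / β ≤ (K : ℝ) ^ 2)
    (hK3 : Dθ ≤ K) (hK4 : Dπ ≤ K) (hb : 1 ≤ b)
    (hc : NoiseConcentrated M φ D K b (43 * (d * L))) {ϑ : Fin d → ℝ} (hϑ : l2norm ϑ ≤ Dθ)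
    {p : Policy X A} (hp : p ∈ softmaxClass φ Dπ) (hv : ∀ x, |valueOf φ ϑ p x| ≤ b) :
    covForm φ β D (psiHat φ β D (valueOf φ ϑ p) - ∑ x, valueOf φ ϑ p x • ψ x)
      (psiHat φ β D (valueOf φ ϑ p) - ∑ x, valueOf φ ϑ p x • ψ x) ≤
      b ^ 2 * (3554 * (d * L / n)) := by
  have hd := hM.dim_pos
  have hR := hM.one_le
  have hd' : (1 : ℝ) ≤ d := by exact_mod_cast hd
  have hn' : (1 : ℝ) ≤ n := by exact_mod_cast hn
  have hT' : (1 : ℝ) ≤ T := by exact_mod_cast hT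
  have hβ0 : 0 < β := by rw [hβ]; positivity
  have hdL : L ≤ d * L := le_mul_of_one_le_left (by linarith) hd'
  have h1 := covForm_psiHat_sub_le (D := D) hβ0 hM hv
  have h2 := hc.covForm_noiseFit_le hβ0 hn hM.norm_feat hR hd hD1 hK1 hK2 hK3 hK4 hb hϑ hp hv
  -- 32 · 43 = 1376, and 200 ≤ 400 d L because d L ≥ 1/2.
  have h3 : (32 * (43 * (d * L)) + 200) / n ≤ 1776 * (d * L / n) := by
    rw [← mul_div_assoc]
    exact div_le_div_of_nonneg_right (by linarith) (by linarith)
  have h4 : β * (b ^ 2 * d) ≤ b ^ 2 * (d * L / n) := by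
    have : β * (b ^ 2 * d) = b ^ 2 * (R ^ 2 / T) := by rw [hβ]; field_simp
    rw [this]
    refine mul_le_mul_of_nonneg_left ?_ (sq_nonneg b)
    rw [div_le_div_iff₀ (by linarith) (by linarith)]
    have := mul_le_mul_of_nonneg_left hdL (by linarith : (0 : ℝ) ≤ T)
    linarith
  have h5 := mul_le_mul_of_nonneg_left h3 (sq_nonneg b)
  linarith

variable [DecidableEq X]

/-- The regret bound on data sets with concentrated noise. -/
theorem IsRun.average_ret_sub_le {D : Fin n → Sample X A} {α ϱ η β Dθ Dπ L E : ℝ} {K : ℕ}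
    {lam : ℕ → Fin d → ℝ} {π : ℕ → Policy X A} {θ : ℕ → Fin d → ℝ}
    (hM : M.IsLinear φ ψ w R)
    (hrun : IsRun φ w M.γ M.x₀ D T α ϱ η β Dθ Dπ (uniformPolicy X A) lam π θ)
    (hn : 1 ≤ n) (hT : 1 ≤ T) (hL : 1 / 2 ≤ L) (hA : 0 < Real.log (Fintype.card A))
    (hT1 : 2 * R ^ 2 * n * Real.log (Fintype.card A) ≤ T * L) (hT2 : R ^ 2 * n ≤ T * L)
    (hDθ : Dθ = √d / (1 - M.γ)) (hDπ : Dπ = α * T * Dθ) (hβ : β = R ^ 2 / (d * T))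
    (hα : α = √(2 * (1 - M.γ) ^ 2 * Real.log (Fintype.card A) / (R ^ 2 * d * T)))
    (hϱ : ϱ = M.γ * √(320 * (d : ℝ) ^ 2 * L / ((1 - M.γ) ^ 2 * n)))
    (hη : η = √((1 - M.γ) ^ 2 / (27 * R ^ 2 * (d : ℝ) ^ 2 * T)))
    (hE : E = √((d : ℝ) ^ 2 * L / n) / (1 - M.γ))
    (hD1 : 1 ≤ Dθ) (hK1 : n * (R * d) * (8 * (R * Dθ) + 1) ≤ K) (hK2 : 4 / β ≤ (K : ℝ) ^ 2)
    (hK3 : Dθ ≤ K) (hK4 : Dπ ≤ K)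
    (hc₁ : NoiseConcentrated M φ D K (R * Dθ) (43 * (d * L)))
    (hc₂ : NoiseConcentrated M φ D K (1 / (1 - M.γ)) (43 * (d * L))) (πs : Policy X A) :
    (T : ℝ)⁻¹ * ∑ t ∈ Finset.Icc 1 T, (M.ret πs - M.ret (π t)) ≤
      2000 * R * E * (invNormSq (covMatrix φ β D) (M.featOcc φ πs) + 1) := by
  have hd := hM.dim_pos
  have hR := hM.one_le
  have hγ := sub_pos.2 M.γ_lt_one
  have hγ0 := M.γ_pos
  have hγ1 := M.γ_lt_one
  have hd' : (1 : ℝ) ≤ d := by exact_mod_cast hd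
  have hn' : (1 : ℝ) ≤ n := by exact_mod_cast hn
  have hT' : (1 : ℝ) ≤ T := by exact_mod_cast hT
  set g := 1 - M.γ with hg
  have hβ0 : 0 < β := by rw [hβ]; positivity
  have hβR : β ≤ R ^ 2 := by
    rw [hβ]; exact div_le_self (by positivity) (one_le_mul_of_one_le_of_one_le hd' hT')
  have hα0 : 0 < α := by rw [hα]; positivity
  have hη0 : 0 < η := by rw [hη]; positivity
  have hE0 : 0 < E := by rw [hE]; positivity
  have hϱE : ϱ = M.γ * (√320 * E) := by
    have : 320 * (d : ℝ) ^ 2 * L / (g ^ 2 * n) = 320 * ((d : ℝ) ^ 2 * L / n / g ^ 2) := by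
      field_simp
    rw [hϱ, hE, this, Real.sqrt_mul (by norm_num), Real.sqrt_div (by positivity),
      Real.sqrt_sq hγ.le]
  have hϱ0 : 0 < ϱ := by rw [hϱE]; positivity
  have hE2 : E ^ 2 = d ^ 2 * L / (n * g ^ 2) := by
    rw [hE, div_pow, Real.sq_sqrt (by positivity), div_div]
  obtain ⟨t1, t2, t3, t4⟩ := tuned_optimization_errors hd' (by linarith) (by linarith) hR hγ hA
    (by linarith) hT1 hT2 hα hη hDθ hE
  have hb₂ : 1 ≤ 1 / g := by rw [le_div_iff₀ hγ]; linarith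
  have herr := fun {b} => covForm_transition_error_le (b := b) (L := L) (D := D) hM hn hT hL hT2 hβ hD1 hK1
    hK2 hK3 hK4
  -- The scale `c = R * E` makes the comparator's error linear in `R * E`. The second error must be
  -- free of `R`: it is divided by `ϱ`, which contains no `R`.
  have hmain := hrun.sum_ret_sub_le (c := R * E) (e₁ := 3554 * (R ^ 2 * E ^ 2))
    (e₂ := 3554 * E ^ 2) hM hn hDθ hDπ hβ0 hβR hα0 hϱ0 hη0 (by positivity)
    (fun ϑ hϑ p hp => by
      refine (herr (one_le_mul_of_one_le_of_one_le hR hD1) hc₁ hϑ hp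
        (abs_valueOf_le hM.norm_feat hϑ p)).trans (le_of_eq ?_)
      rw [mul_pow, hDθ, div_pow, Real.sq_sqrt (by positivity), hE2]
      field_simp)
    (fun ϑ hϑ p hp hv => by
      refine (herr hb₂ hc₂ hϑ hp hv).trans ?_
      have e : (1 / g) ^ 2 * (3554 * (d * L / n)) = 3554 * (d * L / (n * g ^ 2)) := by
        field_simp
      rw [e, hE2]
      gcongr
      nlinarith)
    πs
  rw [inv_mul_le_iff₀ (by linarith)]
  refine hmain.trans (tuned_regret_le hγ0 hγ1.le hR hE0 ?_ (by linarith) hϱE t1 t2 t3 t4)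
  rw [invNormSq_eq_covForm φ D hβ0]
  exact covForm_nonneg φ D hβ0 _

end Main

end FOGAS

end

theorem theorem1 :
    ∃ C : ℝ, 0 < C ∧
      ∀ (X A Ω : Type*) [Fintype X] [DecidableEq X] [Fintype A] [Nonempty A]
        [MeasurableSpace Ω] (P : Measure Ω) [IsProbabilityMeasure P]
        (d n T : ℕ) (M : FOGAS.MDP X A)
        (φ : X → A → Fin d → ℝ) (ψ : X → Fin d → ℝ) (w : Fin d → ℝ) (R δ : ℝ)
        (D : Ω → Fin n → FOGAS.Sample X A)
        (α ϱ η β Dθ Dπ : ℝ),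
        M.IsLinear φ ψ w R →
        FOGAS.IsOfflineData M P D →
        1 ≤ n → 1 ≤ T → 0 < δ →
        2 * R ^ 2 * n * Real.log (Fintype.card A) / Real.log (1 / δ) ≤ (T : ℝ) →
        Dθ = √d / (1 - M.γ) →
        Dπ = α * T * Dθ →
        β = R ^ 2 / (d * T) →
        α = √(2 * (1 - M.γ) ^ 2 * Real.log (Fintype.card A) / (R ^ 2 * d * T)) →
        ϱ = M.γ * √(320 * (d : ℝ) ^ 2 * Real.log (2 * T / δ) / ((1 - M.γ) ^ 2 * n)) →
        η = √((1 - M.γ) ^ 2 / (27 * R ^ 2 * (d : ℝ) ^ 2 * T)) →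
        1 - δ ≤ P.real {ω |
          ∀ (lam : ℕ → Fin d → ℝ) (π : ℕ → FOGAS.Policy X A) (θ : ℕ → Fin d → ℝ),
            FOGAS.IsRun φ w M.γ M.x₀ (D ω) T α ϱ η β Dθ Dπ (FOGAS.uniformPolicy X A) lam π θ →
            ∀ πstar : FOGAS.Policy X A,
              (T : ℝ)⁻¹ * ∑ t ∈ Finset.Icc 1 T, (M.ret πstar - M.ret (π t)) ≤
                C * R * ((FOGAS.invNormSq (FOGAS.covMatrix φ β (D ω)) (M.featOcc φ πstar) + 1) /
                    (1 - M.γ)) *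
                  √((d : ℝ) ^ 2 * Real.log (2 * T / δ) / n)} := by
  refine ⟨2000, by norm_num, ?_⟩
  intro X A Ω _ _ _ _ _ P _ d n T M φ ψ w R δ D α ϱ η β Dθ Dπ hM hD hn hT hδ hTn hDθ hDπ hβ hα
    hϱ hη
  rcases le_or_gt 1 δ with hδ1 | hδ1
  · exact (by linarith : 1 - δ ≤ 0).trans measureReal_nonneg
  have hd := hM.dim_pos
  have hR := hM.one_le
  have hγ := sub_pos.2 M.γ_lt_one
  have hd' : (1 : ℝ) ≤ d := by exact_mod_cast hd
  have hn' : (1 : ℝ) ≤ n := by exact_mod_cast hn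
  have hT' : (1 : ℝ) ≤ T := by exact_mod_cast hT
  have hβ0 : 0 < β := by rw [hβ]; positivity
  set Z := 2 * T / δ with hZdef
  set E := √((d : ℝ) ^ 2 * Real.log Z / n) / (1 - M.γ) with hE
  have h1δ : 1 < 1 / δ := by rw [lt_div_iff₀ hδ]; linarith
  have hZT : 2 * T ≤ Z := by rw [hZdef, le_div_iff₀ hδ]; nlinarith
  have hZ2 : 2 ≤ Z := by linarith
  have hlog2 : (1 / 2 : ℝ) < Real.log 2 := by linarith [Real.log_two_gt_d9]
  have hL : 1 / 2 ≤ Real.log Z :=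
    hlog2.le.trans (Real.log_le_log (by norm_num) hZ2)
  have hE0 : 0 < E := by rw [hE]; positivity
  have hQ0 : ∀ (ω : Ω) (πs : FOGAS.Policy X A),
      0 ≤ FOGAS.invNormSq (FOGAS.covMatrix φ β (D ω)) (M.featOcc φ πs) := fun ω πs => by
    rw [FOGAS.invNormSq_eq_covForm φ (D ω) hβ0]; exact FOGAS.covForm_nonneg φ (D ω) hβ0 _
  have hrhs : ∀ Q : ℝ, 2000 * R * ((Q + 1) / (1 - M.γ)) * √((d : ℝ) ^ 2 * Real.log Z / n) =
      2000 * R * E * (Q + 1) := fun Q => by rw [hE]; ring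
  simp only [hrhs]
  have univ_case : (∀ (ω : Ω) (π : ℕ → FOGAS.Policy X A) (πs : FOGAS.Policy X A),
      (T : ℝ)⁻¹ * ∑ t ∈ Finset.Icc 1 T, (M.ret πs - M.ret (π t)) ≤ 2000 * R * E *
        (FOGAS.invNormSq (FOGAS.covMatrix φ β (D ω)) (M.featOcc φ πs) + 1)) →
      1 - δ ≤ P.real {ω |
        ∀ (lam : ℕ → Fin d → ℝ) (π : ℕ → FOGAS.Policy X A) (θ : ℕ → Fin d → ℝ),
          FOGAS.IsRun φ w M.γ M.x₀ (D ω) T α ϱ η β Dθ Dπ (FOGAS.uniformPolicy X A) lam π θ →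
          ∀ πstar : FOGAS.Policy X A,
            (T : ℝ)⁻¹ * ∑ t ∈ Finset.Icc 1 T, (M.ret πstar - M.ret (π t)) ≤ 2000 * R * E *
              (FOGAS.invNormSq (FOGAS.covMatrix φ β (D ω)) (M.featOcc φ πstar) + 1)} := by
    intro h
    have : (Set.univ : Set Ω) ⊆ {ω |
        ∀ (lam : ℕ → Fin d → ℝ) (π : ℕ → FOGAS.Policy X A) (θ : ℕ → Fin d → ℝ),
          FOGAS.IsRun φ w M.γ M.x₀ (D ω) T α ϱ η β Dθ Dπ (FOGAS.uniformPolicy X A) lam π θ →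
          ∀ πstar : FOGAS.Policy X A,
            (T : ℝ)⁻¹ * ∑ t ∈ Finset.Icc 1 T, (M.ret πstar - M.ret (π t)) ≤ 2000 * R * E *
              (FOGAS.invNormSq (FOGAS.covMatrix φ β (D ω)) (M.featOcc φ πstar) + 1)} :=
      fun ω _ _ π _ _ πs => h ω π πs
    have := measureReal_mono (μ := P) this
    rw [probReal_univ] at this
    linarith
  -- A single action makes `log A`, hence `α`, vanish; but then all policies coincide.
  rcases le_or_gt (Fintype.card A) 1 with hA1 | hA1
  · refine univ_case fun ω π πs => ?_
    have hsub : Subsingleton A := Fintype.card_le_one_iff_subsingleton.1 hA1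
    have heq : ∀ t, π t = πs := fun t => by
      ext x a
      have h1 := (π t).sum_one x
      have h2 := πs.sum_one x
      rw [Fintype.sum_subsingleton _ a] at h1 h2
      rw [h1, h2]
    have := hQ0 ω πs
    simp only [heq, sub_self, Finset.sum_const_zero, mul_zero]
    positivity
  -- If `R * E ≥ 1`, returns in `[0, 1]` make the claim trivial. Otherwise `R * d / (1 - γ)` is
  -- bounded through `n`, which keeps the grid polynomial in `Z`.
  rcases le_or_gt 1 (R * E) with hRE | hRE
  · refine univ_case fun ω π πs => ?_
    have h1 : ∑ t ∈ Finset.Icc 1 T, (M.ret πs - M.ret (π t)) ≤ ∑ _t ∈ Finset.Icc 1 T, (1 : ℝ) :=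
      Finset.sum_le_sum fun t _ => by linarith [M.ret_le_one πs, M.ret_nonneg (π t)]
    simp only [Finset.sum_const, Nat.card_Icc, Nat.add_sub_cancel, nsmul_eq_mul, mul_one] at h1
    rw [inv_mul_le_iff₀ (by linarith)]
    refine h1.trans (le_mul_of_one_le_right (by linarith) ?_)
    linarith [mul_nonneg (hQ0 ω πs) (by linarith : 0 ≤ R * E)]
  have hlδ : 0 < Real.log (1 / δ) := Real.log_pos h1δ
  have hlA : 1 / 2 < Real.log (Fintype.card A) :=
    hlog2.trans_le (Real.log_le_log (by norm_num) (by exact_mod_cast hA1))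
  have hlδL : Real.log (1 / δ) ≤ Real.log Z := by
    refine Real.log_le_log (by positivity) ?_
    rw [hZdef]; gcongr; linarith
  have hlδ1 : T * Real.log (1 / δ) ≤ Z / 2 := by
    have h1 := Real.log_le_sub_one_of_pos (by positivity : 0 < 1 / δ)
    have h2 : T * Real.log (1 / δ) ≤ T * (1 / δ) :=
      mul_le_mul_of_nonneg_left (by linarith) (by linarith)
    have h3 : T * (1 / δ) = Z / 2 := by rw [hZdef]; ring
    linarith
  rw [div_le_iff₀ hlδ] at hTn
  have hR2 : 1 ≤ R ^ 2 := one_le_pow₀ hR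
  -- At least two actions give `log A > 1/2`, so the condition on `T` also controls the terms
  -- without `log A`.
  have hRn : R ^ 2 * n ≤ T * Real.log (1 / δ) := by
    have := mul_le_mul_of_nonneg_left hlA.le (by positivity : 0 ≤ 2 * R ^ 2 * n)
    linarith
  have hTL : T * Real.log (1 / δ) ≤ T * Real.log Z :=
    mul_le_mul_of_nonneg_left hlδL (by linarith)
  have hnZ : 2 * (n : ℝ) ≤ Z := by
    linarith [le_mul_of_one_le_left (by linarith : (0 : ℝ) ≤ n) hR2]
  have hlAZ : Real.log (Fintype.card A) ≤ Z := by
    have h1 : 1 ≤ R ^ 2 * n := one_le_mul_of_one_le_of_one_le hR2 hn'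
    have h2 := le_mul_of_one_le_left (by linarith : 0 ≤ Real.log (Fintype.card A)) h1
    linarith
  have hG : (R * d / (1 - M.γ)) ^ 2 ≤ Z := by
    have h1 : (R * E) ^ 2 ≤ 1 := by
      have : 0 ≤ R * E := by positivity
      exact pow_le_one₀ this hRE.le
    have h2 : (R * E) ^ 2 = (R * d / (1 - M.γ)) ^ 2 * (Real.log Z / n) := by
      rw [hE, mul_pow, div_pow, Real.sq_sqrt (by positivity)]; field_simp
    rw [h2, ← mul_div_assoc, div_le_one (by linarith)] at h1
    linarith [mul_le_mul_of_nonneg_left hL (sq_nonneg (R * d / (1 - M.γ)))]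
  obtain ⟨r1, r2, r3, r4, r5, r6⟩ := FOGAS.net_resolution hd' hR hγ (by linarith [M.γ_pos])
    (by linarith) (by linarith) (by linarith) hZ2 hnZ hZT hlAZ hG hα hDθ hβ hDπ
  have hprob := hD.one_sub_le_real_noiseConcentrated (φ := φ) (b₁ := R * Dθ)
    (b₂ := 1 / (1 - M.γ)) hd hδ hZ2 (by rw [hZdef]; gcongr; linarith) r6
  -- Monotonicity holds for arbitrary sets, so the event quantified over all runs and comparators
  -- need not be measurable.
  refine hprob.trans (measureReal_mono ?_)
  rintro ω ⟨hc₁, hc₂⟩ lam π θ hrun πs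
  exact hrun.average_ret_sub_le hM hn hT hL (by linarith) (hTn.trans hTL) (hRn.trans hTL) hDθ hDπ
    hβ hα hϱ hη hE r1 r2 r3 r4 r5 hc₁ hc₂ πs
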